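/- **Setting.** Fix $\lambda,\lambda_u,P_b,P_u,\sigma,\beta,\alpha_L,\alpha_N,C_0,\Gamma_{cs},\Gamma_{ra}>0$, positive integers $M,N,N_{PA}$ with $N\mid M$, and a measurable $h:[0,\infty)\to[0,1]$. A link of length $r$ is LOS with probability $h(r)$ and NLOS otherwise; its path loss is $\ell_L(r)=\beta r^{\alpha_L}$ if it is LOS and $\ell_N(r)=\beta r^{\alpha_N}$ if it is NLOS. A user beam of width $\theta<2\pi$ has main-lobe gain $G(\theta)=\frac{2\pi}{\theta}\frac{\gamma}{\gamma+1}$ and side-lobe gain $g(\theta)=\frac{2\pi}{2\pi-\theta}\frac{1}{\gamma+1}$, where $\gamma=\frac{2\pi}{C_0(2\pi-\theta)}$; an omnidirectional pattern has $G(2\pi)=1$ and no side lobe ($g(2\pi)=0$). One of the following protocols is used, with $(M_{cs},N_{cs},M_{ra},N_{ra})$ equal to: baseline $(M,N,M,1)$; fast RA $(M,N,1,1)$; fast CS $(m_{cs},N,M,1)$ with $N\le m_{cs}\le M$; omni RX $(M,1,1,N)$. Thus $N=\max(N_{cs},N_{ra})$. Put $K_{cs}=\max(M_{cs},N_{cs})$.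 For $z>0$, $T\ge 0$, $l\ge0$ let $$U(z,T,l)=\exp\Bigl\{-2\pi l\Bigl(\int_0^\infty\frac{Tz\,h(r)\,r\,dr}{Tz+\ell_L(r)}+\int_0^\infty\frac{Tz(1-h(r))\,r\,dr}{Tz+\ell_N(r)}\Bigr)\Bigr\},$$ and let $V(z,T,l)$ be the same expression with the lower limits replaced by $\ell_L^{-1}(z)=(z/\beta)^{1/\alpha_L}$ and $\ell_N^{-1}(z)=(z/\beta)^{1/\alpha_N}$ respectively (with $e^{-\infty}=0$ and $0\cdot\infty=0$). The cell-search success probability is $\hat P=1-(1-\mathcal P)^{K_{cs}}$, where $$\mathcal P=\int_0^\infty \exp\Bigl(-\frac{\Gamma_{cs}z\sigma^2}{P_bM_{cs}G(2\pi/N_{cs})}\Bigr)V\Bigl(z,\Gamma_{cs},\frac{\lambda}{K_{cs}}\Bigr)f_{Z_1}(z)\,dz ,$$ and, with $c=2\pi\lambda/K_{cs}$, $r_L=(z/\beta)^{1/\alpha_L}$, $r_N=(z/\beta)^{1/\alpha_N}$, $$f_{Z_1}(z)=c\Bigl[\tfrac{1}{\alpha_L}\beta^{-2/\alpha_L}z^{2/\alpha_L-1}h(r_L)+\tfrac1{\alpha_N}\beta^{-2/\alpha_N}z^{2/\alpha_N-1}(1-h(r_N))\Bigr]\exp\Bigl(-c\int_0^{r_L}h(r)r\,dr-c\int_0^{r_N}(1-h(r))r\,dr\Bigr).$$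 **Random access.** The typical user is at the origin. Its tagged BS is at a random point $X_0\ne0$, and $Z_0$ is the (LOS or NLOS) path loss of the link between them. Angles are taken in $[0,2\pi)$, and the $j$-th of $n$ beams of a station covers, as seen from that station, the angles $[2\pi(j-1)/n,2\pi j/n)$. Users have $N$ transmit beams and BSs have $M_{ra}$ receive beams. The tagged BS uses the receive beam that covers the typical user, which transmits on the beam that covers $X_0$. The other users in random access form a homogeneous Poisson point process of intensity $\lambda_u\hat P$ on $\mathbb R^2$, independent of the link geometry ($X_0$, the LOS state of the typical link, both beams) and of the preamble of the typical user. Given all of these, each other user independently chooses one of the $N_{PA}$ preambles uniformly, has a LOS link to $X_0$ with probability $h(\text{its distance to }X_0)$, and has a fading power that is exponential with mean 1, independently of one another; its transmit beam is an independent uniformly chosen one of the $N$ beams in the baseline, fast RA and fast CS protocols, and is the current transmit beam of the typical user in the omni RX protocol. The fading power $F_0$ of the typical link is exponential with mean 1 and independent of everything else. Only users with the preamble of the typical user interfere (these form a thinned Poisson process of intensity $\lambda_u\hat P/N_{PA}$). The receive gain of the tagged BS is $M_{ra}$ in its main lobe and $0$ outside. Hence $$\mathrm{SINR}=\frac{P_uM_{ra}G(2\pi/N)F_0/Z_0}{\sum_i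 P_uM_{ra}\,G_i\,F_i/\ell_i+\sigma^2},$$ where the sum is over the users with the preamble of the typical user in the sector of the receive beam, $F_i$ and $\ell_i$ are the fading power and the path loss of the link from user $i$ to $X_0$, and $G_i$ is $G(2\pi/N)$ if the main lobe of user $i$ covers $X_0$ and $g(2\pi/N)$ otherwise. **Lemma.** For every one of these protocols, almost surely, $$\mathbb P(\mathrm{SINR}\ge\Gamma_{ra}\mid Z_0)=\mathbb P(\mathrm{SINR}>\Gamma_{ra}\mid Z_0)=P_{ra}(Z_0,\Gamma_{ra}),$$ where $$P_{ra}(z,\Gamma_{ra})=\exp\Bigl(-\frac{\Gamma_{ra}z\sigma^2}{P_uM_{ra}G(2\pi/N)}\Bigr)\,U\Bigl(z,\Gamma_{ra},\frac{\lambda_u\hat P}{NM_{ra}N_{PA}}\Bigr)\,U\Bigl(z,\frac{g(2\pi/N)}{G(2\pi/N)}\Gamma_{ra},\Bigl(1-\frac1N\Bigr)\frac{\lambda_u\hat P}{M_{ra}N_{PA}}\Bigr).$$ -/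

import Mathlib

open MeasureTheory ProbabilityTheory

noncomputable section

namespace MmWave

/-! ### System parameters, propagation and antenna model -/

/-- The deterministic parameters of the network. Distances are in metres, powers, gains and
thresholds on the linear scale; the total thermal noise power is `σ ^ 2`. -/
structure Params where
  /-- base-station and user intensities -/
  lam : ℝ
  lamU : ℝ
  /-- base-station and user transmit powers -/
  Pb : ℝ
  Pu : ℝ
  /-- square root of the total thermal noise power -/
  σ : ℝ
  /-- path loss at one metre, path loss exponents for LOS and NLOS links -/
  β : ℝ
  αL : ℝ
  αN : ℝ
  /-- constant of the front-back power ratio of the user antennas -/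
  C₀ : ℝ
  /-- SINR thresholds for cell search and random access -/
  Γcs : ℝ
  Γra : ℝ
  /-- `h r` is the probability that a link of length `r` is LOS -/
  h : ℝ → ℝ
  /-- numbers of BS antennas, user antennas, random access preambles -/
  M : ℕ
  N : ℕ
  NPA : ℕ
  lam_pos : 0 < lam
  lamU_pos : 0 < lamU
  Pb_pos : 0 < Pb
  Pu_pos : 0 < Pu
  σ_pos : 0 < σ
  β_pos : 0 < β
  αL_pos : 0 < αL
  αN_pos : 0 < αN
  C₀_pos : 0 < C₀
  Γcs_pos : 0 < Γcs
  Γra_pos : 0 < Γra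
  h_measurable : Measurable h
  h_nonneg : ∀ r, 0 ≤ r → 0 ≤ h r
  h_le_one : ∀ r, 0 ≤ r → h r ≤ 1
  M_pos : 0 < M
  N_pos : 0 < N
  N_dvd_M : N ∣ M
  NPA_pos : 0 < NPA

/-- The four initial access protocols; `fastCS m` sweeps `m` wide BS beams in cell search. -/
inductive Protocol where
  | baseline
  | fastRA
  | fastCS (m : ℕ)
  | omniRX

namespace Protocol

/-- Fast cell search uses a number of wide beams between `N` and `M`. -/
def Admissible (P : Params) : Protocol → Prop
  | fastCS m => P.N ≤ m ∧ m ≤ P.M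
  | _ => True

/-- Number of BS beams swept in cell search. -/
def Mcs (P : Params) : Protocol → ℕ
  | fastCS m => m
  | _ => P.M

/-- Number of user beams swept in cell search. -/
def Ncs (P : Params) : Protocol → ℕ
  | omniRX => 1
  | _ => P.N

/-- Number of BS beams swept in random access. -/
def Mra (P : Params) : Protocol → ℕ
  | baseline => P.M
  | fastCS _ => P.M
  | fastRA => 1
  | omniRX => 1

/-- Number of user beams swept in random access. -/
def Nra (P : Params) : Protocol → ℕ
  | omniRX => P.N
  | _ => 1

/-- Number of BS sectors seen by the typical user in cell search. -/
def Kcs (P : Params) (p : Protocol) : ℕ := max (p.Mcs P) (p.Ncs P)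

end Protocol

/-- Path loss `β r ^ α` of a link of length `r`, LOS or not. -/
def pathLoss (P : Params) (los : Bool) (r : ℝ) : ℝ :=
  P.β * r ^ (if los then P.αL else P.αN)

/-- Front-back power ratio of a user beam of width `θ`. -/
def frontBack (P : Params) (θ : ℝ) : ℝ := 2 * Real.pi / (P.C₀ * (2 * Real.pi - θ))

/-- Main-lobe gain of a user beam of width `θ`. The omnidirectional pattern `θ = 2π`, where the
front-back ratio is infinite, has gain one. -/
def mainGain (P : Params) (θ : ℝ) : ℝ :=
  if θ = 2 * Real.pi then 1
  else 2 * Real.pi / θ * (frontBack P θ / (frontBack P θ + 1))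

/-- Side-lobe gain of a user beam of width `θ < 2π` (an omnidirectional antenna has no side
lobe, and the value `0` which the formula gives at `θ = 2π` is immaterial). -/
def sideGain (P : Params) (θ : ℝ) : ℝ :=
  2 * Real.pi / (2 * Real.pi - θ) * (1 / (frontBack P θ + 1))

/-- The polar angle in `[0, 2π)` of a point of the plane. -/
def polarAngle (x : ℂ) : ℝ := toIcoMod Real.two_pi_pos 0 x.arg

/-- The infinite sector with apex `u` and polar angles in `[a, b)`. -/
def sector (u : ℂ) (a b : ℝ) : Set ℂ := {x | polarAngle (x - u) ∈ Set.Ico a b}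

/-- The area covered by the main lobe of beam `j` (`j = 0, …, n - 1`) out of `n`
non-overlapping beams of width `2π / n` of a station at `u`. -/
def beamArea (u : ℂ) (n : ℕ) (j : Fin n) : Set ℂ :=
  sector u (2 * Real.pi * (j : ℝ) / n) (2 * Real.pi * ((j : ℝ) + 1) / n)

/-! ### The special functions and the cell search success probability -/

/-- `exp (-x)`, with `exp (-∞) = 0`. -/
def expNeg (x : ENNReal) : ℝ := if x = ⊤ then 0 else Real.exp (-x.toReal)

/-- The function `V`; a divergent integral means `V = 0`. -/
def V (P : Params) (z T l : ℝ) : ℝ :=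
  expNeg (ENNReal.ofReal (2 * Real.pi * l) *
    ((∫⁻ r in Set.Ioi ((z / P.β) ^ (1 / P.αL)),
        ENNReal.ofReal (T * z * P.h r * r / (T * z + pathLoss P true r))) +
     ∫⁻ r in Set.Ioi ((z / P.β) ^ (1 / P.αN)),
        ENNReal.ofReal (T * z * (1 - P.h r) * r / (T * z + pathLoss P false r))))

/-- The function `U`; a divergent integral means `U = 0`. -/
def U (P : Params) (z T l : ℝ) : ℝ :=
  expNeg (ENNReal.ofReal (2 * Real.pi * l) *
    ((∫⁻ r in Set.Ioi (0 : ℝ),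
        ENNReal.ofReal (T * z * P.h r * r / (T * z + pathLoss P true r))) +
     ∫⁻ r in Set.Ioi (0 : ℝ),
        ENNReal.ofReal (T * z * (1 - P.h r) * r / (T * z + pathLoss P false r))))

/-- Density of the minimum path loss to the base stations of the typical BS sector. -/
def minPathLossDensity (P : Params) (p : Protocol) (z : ℝ) : ℝ :=
  let c : ℝ := 2 * Real.pi * P.lam / (p.Kcs P : ℝ)
  let rL : ℝ := (z / P.β) ^ (1 / P.αL)
  let rN : ℝ := (z / P.β) ^ (1 / P.αN)
  let eL : ℝ := Real.exp (-c * ∫ r in (0 : ℝ)..rL, P.h r * r)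
  let eN : ℝ := Real.exp (-c * ∫ r in (0 : ℝ)..rN, (1 - P.h r) * r)
  c * (1 / P.αL) * (1 / P.β) ^ (2 / P.αL) * z ^ (2 / P.αL - 1) * P.h rL * eL * eN +
  c * (1 / P.αN) * (1 / P.β) ^ (2 / P.αN) * z ^ (2 / P.αN - 1) * (1 - P.h rN) * eN * eL

/-- Detection probability of the typical BS sector given its minimum path loss `z`. -/
def sectorDetectGiven (P : Params) (p : Protocol) (z : ℝ) : ℝ :=
  Real.exp (-(P.Γcs * z * P.σ ^ 2 /
      (P.Pb * (p.Mcs P : ℝ) * mainGain P (2 * Real.pi / (p.Ncs P : ℝ))))) *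
    V P z P.Γcs (P.lam / (p.Kcs P : ℝ))

/-- Detection probability of the typical BS sector. -/
def sectorDetect (P : Params) (p : Protocol) : ℝ :=
  ∫ z in Set.Ioi (0 : ℝ), sectorDetectGiven P p z * minPathLossDensity P p z

/-- Success probability of cell search. -/
def cellSearchProb (P : Params) (p : Protocol) : ℝ :=
  1 - (1 - sectorDetect P p) ^ (p.Kcs P)

/-! ### Poisson point processes and independent marks -/

variable {Ω : Type*} [MeasurableSpace Ω]

/-- Number of points in `B` of the process that consists of those `loc i ω` for which
`present i ω` holds. -/
def pointCount {E : Type*} (present : ℕ → Ω → Bool) (loc : ℕ → Ω → E) (B : Set E) (ω : Ω) : ℕ∞ :=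
  {i : ℕ | present i ω = true ∧ loc i ω ∈ B}.encard

/-- The points `loc i ω` with `present i ω` form a Poisson point process with intensity
measure `ν`. -/
structure IsPoissonProcess {E : Type*} [MeasurableSpace E] (μ : Measure Ω)
    (present : ℕ → Ω → Bool) (loc : ℕ → Ω → E) (ν : Measure E) : Prop where
  measurable_present : ∀ i, Measurable (present i)
  measurable_loc : ∀ i, Measurable (loc i)
  poisson : ∀ B : Set E, MeasurableSet B → ν B ≠ ⊤ → ∀ k : ℕ,
    μ {ω | pointCount present loc B ω = k} = poissonMeasure (ν B).toNNReal {k}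
  indep : ∀ (n : ℕ) (B : Fin n → Set E), (∀ j, MeasurableSet (B j)) →
    Pairwise (Function.onFun Disjoint B) →
    iIndepFun (fun j => pointCount present loc (B j)) μ

/-- Given the random element `X` (which holds the locations of all points and everything else
on which the marks may depend), the marks `mark i` are independent and the `i`-th one has the
law `κ i X`. -/
def IsIndependentMarking {S T : Type*} [MeasurableSpace S] [MeasurableSpace T] (μ : Measure Ω)
    (X : Ω → S) (mark : ℕ → Ω → T) (κ : ℕ → S → Measure T) : Prop :=
  (∀ i, Measurable (mark i)) ∧
  ∀ (n : ℕ) (A : Set S) (B : Fin n → Set T), MeasurableSet A → (∀ i, MeasurableSet (B i)) →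
    μ {ω | X ω ∈ A ∧ ∀ i : Fin n, mark i ω ∈ B i} =
      ∫⁻ ω in X ⁻¹' A, ∏ i : Fin n, κ i (X ω) (B i) ∂μ

/-! ### The random access phase -/

/-- What belongs to the link between the typical user, at the origin, and its tagged BS. -/
structure TypicalLink (P : Params) (p : Protocol) (Ω : Type*) where
  /-- location of the tagged BS -/
  X₀ : Ω → ℂ
  /-- whether the link is LOS -/
  los₀ : Ω → Bool
  /-- receive beam of the tagged BS -/
  rxBeam : Ω → Fin (p.Mra P)
  /-- transmit beam of the typical user -/
  txBeam : Ω → Fin P.N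
  /-- preamble of the typical user -/
  preamble₀ : Ω → Fin P.NPA
  /-- Rayleigh fading power of the link -/
  F₀ : Ω → ℝ

/-- All of the typical link except its fading. -/
def TypicalLink.geometry {P : Params} {p : Protocol} (L : TypicalLink P p Ω) (ω : Ω) :
    ℂ × Bool × Fin (p.Mra P) × Fin P.N × Fin P.NPA :=
  (L.X₀ ω, L.los₀ ω, L.rxBeam ω, L.txBeam ω, L.preamble₀ ω)

/-- Path loss from the typical user to the tagged BS. -/
def TypicalLink.Z₀ {P : Params} {p : Protocol} (L : TypicalLink P p Ω) (ω : Ω) : ℝ :=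
  pathLoss P (L.los₀ ω) ‖L.X₀ ω‖

/-- Mark of another user: its preamble, whether its link to the tagged BS is LOS, its transmit
beam, and the fading power of that link. -/
abbrev UserMark (P : Params) : Type := Fin P.NPA × Bool × Fin P.N × ℝ

/-- The other users that take part in random access. -/
structure OtherUsers (P : Params) (Ω : Type*) where
  present : ℕ → Ω → Bool
  loc : ℕ → Ω → ℂ
  mark : ℕ → Ω → UserMark P

/-- The enumerated points of the user process. -/
def OtherUsers.points {P : Params} (R : OtherUsers P Ω) (ω : Ω) : ℕ → Bool × ℂ :=
  fun i => (R.present i ω, R.loc i ω)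

/-- A link of length `r` is LOS with probability `h r`. -/
def losLaw (P : Params) (r : ℝ) : Measure Bool :=
  ENNReal.ofReal (P.h r) • Measure.dirac true + ENNReal.ofReal (1 - P.h r) • Measure.dirac false

/-- Law of the transmit beam of another user, while the typical user transmits on beam `b`:
the users sweep their beams synchronously in the omni-RX protocol, and otherwise each user
transmits on a fixed beam, which is uniformly distributed. -/
def beamLaw (P : Params) (p : Protocol) (b : Fin P.N) : Measure (Fin P.N) :=
  match p with
  | .omniRX => Measure.dirac b
  | _ => uniformOn Set.univ

/-- Law of the mark of a user at distance `r` from the tagged BS, while the typical user transmits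
on beam `b`. -/
def markLaw (P : Params) (p : Protocol) (b : Fin P.N) (r : ℝ) : Measure (UserMark P) :=
  (uniformOn (Set.univ : Set (Fin P.NPA))).prod
    ((losLaw P r).prod ((beamLaw P p b).prod (expMeasure 1)))

/-- The probabilistic model of the random access phase. -/
structure IsRandomAccessModel (P : Params) (p : Protocol) (μ : Measure Ω)
    (L : TypicalLink P p Ω) (R : OtherUsers P Ω) : Prop where
  measurable_geometry : Measurable L.geometry
  measurable_F₀ : Measurable L.F₀
  /-- the tagged BS is not at the location of the typical user -/
  X₀_ne : ∀ᵐ ω ∂μ, L.X₀ ω ≠ 0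
  /-- the beams of the typical user and of the tagged BS are aligned -/
  rx_aligned : ∀ᵐ ω ∂μ, (0 : ℂ) ∈ beamArea (L.X₀ ω) (p.Mra P) (L.rxBeam ω)
  tx_aligned : ∀ᵐ ω ∂μ, L.X₀ ω ∈ beamArea 0 P.N (L.txBeam ω)
  /-- the users in random access: a homogeneous Poisson process, independent of the typical link -/
  users : IsPoissonProcess μ R.present R.loc
    (ENNReal.ofReal (P.lamU * cellSearchProb P p) • (volume : Measure ℂ))
  users_indep : IndepFun L.geometry R.points μ
  /-- given all locations, the marks of the users are independent -/
  marks : IsIndependentMarking μ (fun ω => (L.geometry ω, R.points ω)) R.mark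
    (fun i x => markLaw P p x.1.2.2.2.1 ‖(x.2 i).2 - x.1.1‖)
  /-- the fading of the typical link is independent of all the rest -/
  fading_law : μ.map L.F₀ = expMeasure 1
  fading_indep : IndepFun L.F₀
    (fun ω => ((L.geometry ω, R.points ω), fun i => R.mark i ω)) μ

open Classical in
/-- Receive gain of the tagged BS towards a transmitter at `x`: `Mra` in the main lobe of its
receive beam, and `0` in the side lobe. -/
def rxGain {P : Params} {p : Protocol} (L : TypicalLink P p Ω) (ω : Ω) (x : ℂ) : ℝ :=
  if x ∈ beamArea (L.X₀ ω) (p.Mra P) (L.rxBeam ω) then (p.Mra P : ℝ) else 0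

open Classical in
/-- Transmit gain towards the tagged BS of a user at `x` that transmits on beam `b`. -/
def txGain {P : Params} {p : Protocol} (L : TypicalLink P p Ω) (ω : Ω) (x : ℂ) (b : Fin P.N) : ℝ :=
  if L.X₀ ω ∈ beamArea x P.N b then mainGain P (2 * Real.pi / (P.N : ℝ))
  else sideGain P (2 * Real.pi / (P.N : ℝ))

open Classical in
/-- Power received by the tagged BS from the other users with the preamble of the typical user. -/
def interference {P : Params} {p : Protocol} (L : TypicalLink P p Ω) (R : OtherUsers P Ω)
    (ω : Ω) : ENNReal :=
  ∑' i : ℕ,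
    if R.present i ω = true ∧ (R.mark i ω).1 = L.preamble₀ ω then
      ENNReal.ofReal (P.Pu * rxGain L ω (R.loc i ω) * txGain L ω (R.loc i ω) (R.mark i ω).2.2.1 *
        (R.mark i ω).2.2.2 / pathLoss P (R.mark i ω).2.1 ‖R.loc i ω - L.X₀ ω‖)
    else 0

/-- SINR at the tagged BS of the preamble of the typical user. -/
def preambleSINR {P : Params} {p : Protocol} (L : TypicalLink P p Ω) (R : OtherUsers P Ω)
    (ω : Ω) : ENNReal :=
  ENNReal.ofReal (P.Pu * rxGain L ω 0 * txGain L ω 0 (L.txBeam ω) * L.F₀ ω / L.Z₀ ω) /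
    (interference L R ω + ENNReal.ofReal (P.σ ^ 2))

/-- The function `P_ra`: noise factor, main-lobe factor and side-lobe factor, at path loss `z`. -/
def preambleProb (P : Params) (p : Protocol) (z : ℝ) : ℝ :=
  let N : ℝ := (max (p.Ncs P) (p.Nra P) : ℕ)
  let G : ℝ := mainGain P (2 * Real.pi / N)
  let g : ℝ := sideGain P (2 * Real.pi / N)
  Real.exp (-(P.Γra * z * P.σ ^ 2 / (P.Pu * (p.Mra P : ℝ) * G))) *
    U P z P.Γra (P.lamU * cellSearchProb P p / (N * (p.Mra P : ℝ) * (P.NPA : ℝ))) *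
    U P z (g / G * P.Γra)
      ((1 - 1 / N) * (P.lamU * cellSearchProb P p / ((p.Mra P : ℝ) * (P.NPA : ℝ))))

end MmWave

end

open scoped ENNReal NNReal

/-! Write s = Γ_ra Z₀ / (P_u M_ra G) and let I be the interference. Up to a null set, the SINR
reaches the threshold exactly when F₀ reaches s (I + σ²), because both beams are aligned
(`IsRandomAccessModel.ae_sinr_iff`). Since F₀ is exponential and independent of the rest, the
probability given the rest is exp(-s (I + σ²)). The exponential law has no atoms, so ≥ and > give
the same value. It remains to compute a Laplace transform of I at a level s that depends on the link
geometry.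

Given the geometry and all user locations, the marks are independent. Averaging over them replaces
the user at x by a factor v(x) ≤ 1 (`IsIndependentMarking.setLIntegral_expNegE_tsum`,
`LinkGeometry.userFactor`). The product of these factors is exp of minus the sum of -log v over the
points. As the points are independent of the geometry, the Laplace functional of a Poisson process
(`IsPoissonProcess.lintegral_expNegE_pointSum`) at the function -log v gives exp(-∫ (1 - v) dν).
Preamble, receive sector, LOS state and beam all enter through v, so no thinned or marked Poisson
process has to be constructed.

For the integral, exponential fading gives Tz / (Tz + ℓ) with T = Γ_ra or (g/G) Γ_ra, the preamble
gives 1/N_PA, and polar coordinates around the tagged BS give the angular factors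
(`lintegral_rxBeam`). With uniform beams, a user in the sector of angle 2π/M_ra points its main lobe
at the BS with probability 1/N. In omni RX all users share one beam, but M_ra = 1, and the users
whose main lobe hits the BS fill a sector of angle 2π/N. The two weights are therefore the same.

The result depends on the geometry only through Z₀, so integrating it over the events Z₀ ∈ B
identifies the conditional probability (`condExp_indicator_ae_eq_comp`). All transforms take values
in [0, ∞], so infinite interference and divergent integrals need no separate treatment: exp(-∞) = 0.
-/

/-! ### Exponential and logarithm on [0, ∞] -/

/-- The function `exp (-x)` on the extended nonnegative reals. -/
noncomputable def expNegE (x : ℝ≥0∞) : ℝ≥0∞ := EReal.exp (-(x : EReal))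

@[simp] lemma expNegE_zero : expNegE 0 = 1 := by simp [expNegE]

@[simp] lemma expNegE_top : expNegE ⊤ = 0 := by simp [expNegE]

lemma continuous_expNegE : Continuous expNegE :=
  ENNReal.continuous_exp.comp (continuous_neg.comp continuous_coe_ennreal_ereal)

@[fun_prop]
lemma measurable_expNegE : Measurable expNegE := continuous_expNegE.measurable

lemma expNegE_antitone : Antitone expNegE := fun _ _ h =>
  EReal.exp_monotone (EReal.neg_le_neg_iff.2 (EReal.coe_ennreal_le_coe_ennreal_iff.2 h))

lemma expNegE_le_one (x : ℝ≥0∞) : expNegE x ≤ 1 := by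
  simpa using expNegE_antitone (zero_le (a := x))

lemma expNegE_ne_top (x : ℝ≥0∞) : expNegE x ≠ ⊤ :=
  ((expNegE_le_one x).trans_lt ENNReal.one_lt_top).ne

lemma expNegE_ofReal {r : ℝ} (hr : 0 ≤ r) :
    expNegE (ENNReal.ofReal r) = ENNReal.ofReal (Real.exp (-r)) := by
  rw [expNegE, EReal.coe_ennreal_ofReal, max_eq_left hr, ← EReal.coe_neg, EReal.exp_coe]

lemma expNegE_add (x y : ℝ≥0∞) : expNegE (x + y) = expNegE x * expNegE y := by
  rw [expNegE, expNegE, expNegE, EReal.coe_ennreal_add, EReal.neg_add, sub_eq_add_neg,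
    EReal.exp_add] <;> simp

lemma expNegE_sum {ι : Type*} (s : Finset ι) (f : ι → ℝ≥0∞) :
    expNegE (∑ i ∈ s, f i) = ∏ i ∈ s, expNegE (f i) := by
  classical
  induction s using Finset.induction_on with
  | empty => simp
  | insert a s ha ih => rw [Finset.sum_insert ha, Finset.prod_insert ha, expNegE_add, ih]

lemma expNeg_eq_toReal (x : ℝ≥0∞) : MmWave.expNeg x = (expNegE x).toReal := by
  by_cases h : x = ⊤
  · simp [MmWave.expNeg, h]
  · rw [MmWave.expNeg, if_neg h]
    conv_rhs => rw [← ENNReal.ofReal_toReal h, expNegE_ofReal ENNReal.toReal_nonneg]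
    rw [ENNReal.toReal_ofReal (Real.exp_pos _).le]

/-- The function `-log` on `[0, 1]`. -/
noncomputable def negLogE (v : ℝ≥0∞) : ℝ≥0∞ := (-(ENNReal.log v)).toENNReal

@[fun_prop]
lemma measurable_negLogE : Measurable negLogE :=
  EReal.continuous_toENNReal.measurable.comp
    (continuous_neg.measurable.comp ENNReal.measurable_log)

/-- For v ≤ 1 the number -log v is nonnegative, so truncation at zero loses nothing; v = 0
corresponds to the value ⊤. -/
lemma expNegE_negLogE {v : ℝ≥0∞} (hv : v ≤ 1) : expNegE (negLogE v) = v := by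
  have h : 0 ≤ -(ENNReal.log v) := by
    rw [EReal.neg_nonneg]; exact ENNReal.log_le_zero_iff.2 hv
  rw [negLogE, expNegE, EReal.coe_toENNReal h, neg_neg, ENNReal.exp_log]

namespace MmWave

/-! ### Laplace functional of a Poisson process -/

section Laplace

variable {Ω E : Type*} {present : ℕ → Ω → Bool} {loc : ℕ → Ω → E}

/-- The sum of `f` over the points of the process. -/
noncomputable def pointSum (present : ℕ → Ω → Bool) (loc : ℕ → Ω → E) (f : E → ℝ≥0∞) (ω : Ω) :
    ℝ≥0∞ :=
  ∑' i, if present i ω = true then f (loc i ω) else 0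

lemma pointCount_eq_pointSum (B : Set E) (ω : Ω) :
    (pointCount present loc B ω : ℝ≥0∞) = pointSum present loc (B.indicator 1) ω := by
  rw [pointCount, ← ENNReal.tsum_set_one, pointSum, tsum_subtype _ (fun _ => (1 : ℝ≥0∞))]
  refine tsum_congr fun i => ?_
  by_cases h1 : present i ω = true <;> by_cases h2 : loc i ω ∈ B <;>
    simp [Set.indicator, h1, h2]

lemma pointSum_finset_sum {ι : Type*} (s : Finset ι) (c : ι → ℝ≥0∞) (B : ι → Set E) (ω : Ω) :
    pointSum present loc (fun x => ∑ j ∈ s, c j * (B j).indicator 1 x) ω =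
      ∑ j ∈ s, c j * pointCount present loc (B j) ω := by
  simp_rw [pointCount_eq_pointSum, pointSum, ← ENNReal.tsum_mul_left]
  rw [← Summable.tsum_finsetSum (fun _ _ => ENNReal.summable)]
  refine tsum_congr fun i => ?_
  split_ifs <;> simp

variable [MeasurableSpace Ω] [MeasurableSpace E] {μ : Measure Ω} {ν : Measure E}

lemma measurable_pointSum (hp : ∀ i, Measurable (present i)) (hl : ∀ i, Measurable (loc i))
    {f : E → ℝ≥0∞} (hf : Measurable f) : Measurable (pointSum present loc f) := by
  refine Measurable.tsum fun i => ?_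
  exact Measurable.ite (hp i (measurableSet_singleton true)) (hf.comp (hl i)) measurable_const

lemma measurable_pointCount (hp : ∀ i, Measurable (present i)) (hl : ∀ i, Measurable (loc i))
    {B : Set E} (hB : MeasurableSet B) : Measurable (pointCount present loc B) := by
  refine measurable_to_countable' fun k => ?_
  have h : pointCount present loc B ⁻¹' {k} =
      pointSum present loc (B.indicator 1) ⁻¹' {(k : ℝ≥0∞)} := by
    ext ω
    simp only [Set.mem_preimage, Set.mem_singleton_iff, ← pointCount_eq_pointSum]
    exact ENat.toENNReal_inj.symm
  rw [h]
  exact measurable_pointSum hp hl (measurable_one.indicator hB) (measurableSet_singleton _)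

/-- The terms e^{-r} (r e^{-c})^k / k! add up to an exponential series. -/
lemma lintegral_expNegE_mul_poissonMeasure (r : ℝ≥0) {c : ℝ≥0∞} (hc : c ≠ ⊤) :
    ∫⁻ k : ℕ, expNegE (c * k) ∂(poissonMeasure r) = expNegE (r * (1 - expNegE c)) := by
  lift c to ℝ≥0 using hc
  have hE : expNegE (c : ℝ≥0∞) = ENNReal.ofReal (Real.exp (-c)) := by
    rw [← ENNReal.ofReal_coe_nnreal, expNegE_ofReal c.coe_nonneg]
  have h1 : Real.exp (-(c : ℝ)) ≤ 1 := Real.exp_le_one_iff.2 (by simp)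
  have hR : (r : ℝ≥0∞) * (1 - expNegE c) = ENNReal.ofReal (r * (1 - Real.exp (-c))) := by
    rw [hE, ENNReal.ofReal_mul r.coe_nonneg, ENNReal.ofReal_sub _ (Real.exp_pos _).le,
      ENNReal.ofReal_one, ENNReal.ofReal_coe_nnreal]
  rw [hR, expNegE_ofReal (mul_nonneg r.coe_nonneg (by linarith)), lintegral_countable']
  have hs := (NormedSpace.expSeries_div_hasSum_exp (𝔸 := ℝ) (r * Real.exp (-(c : ℝ)))).mul_left
    (Real.exp (-(r : ℝ)))
  rw [← Real.exp_eq_exp_ℝ, ← Real.exp_add] at hs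
  have e1 : -(r : ℝ) + r * Real.exp (-(c : ℝ)) = -(r * (1 - Real.exp (-c))) := by ring
  rw [e1] at hs
  rw [← hs.tsum_eq, ENNReal.ofReal_tsum_of_nonneg _ hs.summable]
  · refine tsum_congr fun k => ?_
    have : (c : ℝ≥0∞) * k = ENNReal.ofReal (c * k) := by
      rw [ENNReal.ofReal_mul c.coe_nonneg]; simp
    rw [this, expNegE_ofReal (by positivity), poissonMeasure_singleton,
      ← ENNReal.ofReal_mul (Real.exp_pos _).le]
    congr 1
    rw [mul_pow, ← Real.exp_nat_mul]
    have : (k : ℝ) * -(c : ℝ) = -(c * k) := by ring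
    rw [this]
    ring
  · intro k
    positivity

variable [IsProbabilityMeasure μ]

/-- The model prescribes the probabilities of finite counts only. On both sides the mass at ⊤ is the
complement of the total finite mass, so it agrees as well. -/
lemma IsPoissonProcess.map_pointCount (h : IsPoissonProcess μ present loc ν) {B : Set E}
    (hB : MeasurableSet B) (hν : ν B ≠ ⊤) :
    μ.map (pointCount present loc B) =
      (poissonMeasure (ν B).toNNReal).map (Nat.cast : ℕ → ℕ∞) := by
  have hm := measurable_pointCount h.measurable_present h.measurable_loc hB
  have hc : Measurable (Nat.cast : ℕ → ℕ∞) := measurable_from_top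
  have : IsProbabilityMeasure (μ.map (pointCount present loc B)) :=
    Measure.isProbabilityMeasure_map hm.aemeasurable
  have : IsProbabilityMeasure ((poissonMeasure (ν B).toNNReal).map (Nat.cast : ℕ → ℕ∞)) :=
    Measure.isProbabilityMeasure_map hc.aemeasurable
  have hk : ∀ k : ℕ, μ.map (pointCount present loc B) {(k : ℕ∞)} =
      (poissonMeasure (ν B).toNNReal).map (Nat.cast : ℕ → ℕ∞) {(k : ℕ∞)} := by
    intro k
    rw [Measure.map_apply hm (measurableSet_singleton _),
      Measure.map_apply hc (measurableSet_singleton _)]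
    have e : (Nat.cast : ℕ → ℕ∞) ⁻¹' {(k : ℕ∞)} = {k} := by ext; simp
    rw [e]
    exact h.poisson B hB hν k
  have htop : ({⊤} : Set ℕ∞) = (⋃ k : ℕ, {(k : ℕ∞)})ᶜ := by
    ext x
    induction x using ENat.recTopCoe <;> simp
  refine Measure.ext_of_singleton fun k => ?_
  induction k using ENat.recTopCoe with
  | coe k => exact hk k
  | top =>
    rw [htop, prob_compl_eq_one_sub (MeasurableSet.of_discrete),
      prob_compl_eq_one_sub (MeasurableSet.of_discrete),
      measure_iUnion, measure_iUnion]
    · simp_rw [hk]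
    · intro i j hij; simpa using hij
    · intro i; exact MeasurableSet.of_discrete
    · intro i j hij; simpa using hij
    · intro i; exact MeasurableSet.of_discrete

lemma IsPoissonProcess.lintegral_expNegE_mul_pointCount (h : IsPoissonProcess μ present loc ν)
    {B : Set E} (hB : MeasurableSet B) (hν : ν B ≠ ⊤) {c : ℝ≥0∞} (hc : c ≠ ⊤) :
    ∫⁻ ω, expNegE (c * pointCount present loc B ω) ∂μ = expNegE (ν B * (1 - expNegE c)) := by
  have hm := measurable_pointCount h.measurable_present h.measurable_loc hB
  have h1 := lintegral_map (μ := μ) (f := fun k : ℕ∞ => expNegE (c * k)) measurable_from_top hm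
  rw [← h1, h.map_pointCount hB hν, lintegral_map measurable_from_top measurable_from_top]
  simp only [ENat.toENNReal_coe]
  rw [lintegral_expNegE_mul_poissonMeasure _ hc, ENNReal.coe_toNNReal hν]

/-- Laplace functional of a Poisson process at a simple function of finite support. -/
lemma IsPoissonProcess.lintegral_expNegE_simpleFunc (h : IsPoissonProcess μ present loc ν)
    (f : SimpleFunc E ℝ≥0∞) (hf : ∀ x, f x ≠ ⊤) (hs : ν (Function.support f) ≠ ⊤) :
    ∫⁻ ω, expNegE (pointSum present loc f ω) ∂μ = expNegE (∫⁻ x, (1 - expNegE (f x)) ∂ν) := by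
  classical
  -- Only nonzero values are enumerated: their level sets lie in the support, hence have finite
  -- intensity, and are disjoint, hence have independent counts.
  set s := f.range.filter (· ≠ 0) with hs'
  let e := s.equivFin
  let c : Fin s.card → ℝ≥0∞ := fun j => (e.symm j : ℝ≥0∞)
  let B : Fin s.card → Set E := fun j => f ⁻¹' {c j}
  have hcinj : Function.Injective c := Subtype.val_injective.comp e.symm.injective
  have hB : ∀ j, MeasurableSet (B j) := fun j => f.measurableSet_fiber _
  have hc0 : ∀ j, c j ≠ 0 := fun j => (Finset.mem_filter.1 (e.symm j).2).2
  have hctop : ∀ j, c j ≠ ⊤ := fun j => by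
    obtain ⟨x, hx⟩ := SimpleFunc.mem_range.1 (Finset.mem_filter.1 (e.symm j).2).1
    have : f x = c j := hx
    exact this ▸ hf x
  have hBν : ∀ j, ν (B j) ≠ ⊤ := fun j => by
    refine ne_top_of_le_ne_top hs (measure_mono fun x hx => ?_)
    have : f x = c j := hx
    simp [this, hc0 j]
  have hdis : Pairwise (Function.onFun Disjoint B) := fun i j hij => by
    refine Set.disjoint_left.2 fun x hx hx' => hij (hcinj ?_)
    exact (show f x = c i from hx).symm.trans hx'
  -- Needed for two choices of g: the identity, for the point sum, and y ↦ 1 - exp(-y), for the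
  -- integral against ν.
  have key : ∀ (g : ℝ≥0∞ → ℝ≥0∞) (_ : g 0 = 0) (x : E),
      g (f x) = ∑ j, g (c j) * (B j).indicator 1 x := by
    intro g hg x
    by_cases h0 : f x = 0
    · rw [h0, hg]
      symm
      refine Finset.sum_eq_zero fun j _ => ?_
      rw [Set.indicator_of_notMem, mul_zero]
      intro hx
      exact hc0 j ((show f x = c j from hx).symm.trans h0)
    · have hmem : f x ∈ s := Finset.mem_filter.2 ⟨f.mem_range_self x, h0⟩
      have hcj : c (e ⟨f x, hmem⟩) = f x := by simp [c]
      rw [Finset.sum_eq_single (e ⟨f x, hmem⟩)]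
      · rw [Set.indicator_of_mem, hcj]
        · simp
        · exact hcj.symm
      · intro j _ hj
        rw [Set.indicator_of_notMem, mul_zero]
        intro hx
        exact hj (hcinj ((show f x = c j from hx).symm.trans hcj.symm))
      · simp
  have hsum : ∀ ω, pointSum present loc f ω = ∑ j, c j * pointCount present loc (B j) ω := by
    intro ω
    rw [← pointSum_finset_sum]
    congr 1
    funext x
    exact key id rfl x
  have hmc := fun j => measurable_pointCount h.measurable_present h.measurable_loc (hB j)
  have hind := (h.indep _ B hB hdis).comp (fun j (k : ℕ∞) => expNegE (c j * k))
    (fun j => measurable_from_top)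
  have hl : ∫⁻ ω, expNegE (pointSum present loc f ω) ∂μ =
      ∏ j, ∫⁻ ω, expNegE (c j * pointCount present loc (B j) ω) ∂μ := by
    simp_rw [hsum, expNegE_sum]
    exact lintegral_prod_eq_prod_lintegral_of_indepFun _ _ hind
      (fun j => Measurable.comp (g := fun k : ℕ∞ => expNegE (c j * k)) measurable_from_top (hmc j))
  have hr : ∫⁻ x, (1 - expNegE (f x)) ∂ν = ∑ j, ν (B j) * (1 - expNegE (c j)) := by
    simp_rw [key (fun y => 1 - expNegE y) (by simp)]
    rw [lintegral_finsetSum]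
    · refine Finset.sum_congr rfl fun j _ => ?_
      rw [lintegral_const_mul _ (measurable_one.indicator (hB j)), lintegral_indicator_one (hB j),
        mul_comm]
    · intro j _
      exact (measurable_one.indicator (hB j)).const_mul _
  rw [hl, hr, expNegE_sum]
  exact Finset.prod_congr rfl fun j _ =>
    h.lintegral_expNegE_mul_pointCount (hB j) (hBν j) (hctop j)

/-- Monotone convergence for the counting measure. -/
lemma tendsto_tsum_of_monotone {ι : Type*} {a : ℕ → ι → ℝ≥0∞} (ha : Monotone a) :
    Filter.Tendsto (fun n => ∑' i, a n i) Filter.atTop (nhds (∑' i, ⨆ n, a n i)) := by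
  have : ∑' i, ⨆ n, a n i = ⨆ n, ∑' i, a n i := by
    let : MeasurableSpace ι := ⊤
    simp_rw [← lintegral_count]
    exact lintegral_iSup (fun n => measurable_from_top) ha
  rw [this]
  exact tendsto_atTop_iSup fun n m hnm => ENNReal.tsum_le_tsum (ha hnm)

/-- Laplace functional of a Poisson process. -/
theorem IsPoissonProcess.lintegral_expNegE_pointSum [SigmaFinite ν]
    (h : IsPoissonProcess μ present loc ν) {f : E → ℝ≥0∞} (hf : Measurable f) :
    ∫⁻ ω, expNegE (pointSum present loc f ω) ∂μ = expNegE (∫⁻ x, (1 - expNegE (f x)) ∂ν) := by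
  -- Cutting the finite-valued approximations off outside sets of finite intensity makes the
  -- simple-function case applicable, and F n still increases to f.
  let F : ℕ → SimpleFunc E ℝ≥0∞ := fun n =>
    (SimpleFunc.eapprox f n).restrict (spanningSets ν n)
  have hFapp : ∀ n x, F n x = (spanningSets ν n).indicator (SimpleFunc.eapprox f n) x := fun n x =>
    SimpleFunc.restrict_apply _ (measurableSet_spanningSets ν n) x
  have hmono : ∀ x, Monotone fun n => F n x := by
    intro x n m hnm
    simp only [hFapp]
    by_cases hx : x ∈ spanningSets ν n
    · rw [Set.indicator_of_mem hx, Set.indicator_of_mem (monotone_spanningSets ν hnm hx)]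
      exact SimpleFunc.monotone_eapprox f hnm x
    · rw [Set.indicator_of_notMem hx]
      exact zero_le
  have hsup : ∀ x, ⨆ n, F n x = f x := by
    intro x
    refine le_antisymm (iSup_le fun n => ?_) ?_
    · rw [hFapp, ← SimpleFunc.iSup_eapprox_apply hf x]
      exact (Set.indicator_le_self _ _ x).trans (le_iSup (fun n => SimpleFunc.eapprox f n x) n)
    · rw [← SimpleFunc.iSup_eapprox_apply hf x]
      refine iSup_le fun n => ?_
      have hx := mem_spanningSetsIndex ν x
      set k := spanningSetsIndex ν x
      refine le_trans ?_ (le_iSup (fun n => F n x) (max n k))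
      rw [hFapp, Set.indicator_of_mem (monotone_spanningSets ν (le_max_right n k) hx)]
      exact SimpleFunc.monotone_eapprox f (le_max_left n k) x
  have heq : ∀ n, ∫⁻ ω, expNegE (pointSum present loc (F n) ω) ∂μ =
      expNegE (∫⁻ x, (1 - expNegE (F n x)) ∂ν) := by
    intro n
    refine h.lintegral_expNegE_simpleFunc (F n) (fun x => ?_) ?_
    · rw [hFapp]
      refine ne_top_of_le_ne_top ?_ (Set.indicator_le_self _ _ x)
      exact (SimpleFunc.eapprox_lt_top f n x).ne
    · refine ne_top_of_le_ne_top (measure_spanningSets_lt_top ν n).ne (measure_mono fun x hx => ?_)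
      by_contra hx'
      exact hx (by rw [hFapp, Set.indicator_of_notMem hx'])
  have hL : Filter.Tendsto (fun n => ∫⁻ ω, expNegE (pointSum present loc (F n) ω) ∂μ)
      Filter.atTop (nhds (∫⁻ ω, expNegE (pointSum present loc f ω) ∂μ)) := by
    refine tendsto_lintegral_of_dominated_convergence (fun _ => 1)
      (fun n => measurable_expNegE.comp
        (measurable_pointSum h.measurable_present h.measurable_loc (F n).measurable))
      (fun n => ae_of_all _ fun ω => expNegE_le_one _) (by simp) (ae_of_all _ fun ω => ?_)
    refine (continuous_expNegE.tendsto _).comp ?_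
    have := tendsto_tsum_of_monotone
      (a := fun n i => if present i ω = true then F n (loc i ω) else 0) (by
        intro n m hnm i
        dsimp only
        split_ifs
        · exact hmono _ hnm
        · exact le_rfl)
    have hlim : pointSum present loc f ω =
        ∑' i, ⨆ n, if present i ω = true then F n (loc i ω) else 0 := by
      refine tsum_congr fun i => ?_
      split_ifs
      · exact (hsup _).symm
      · simp
    rw [hlim]
    exact this
  have hR : Filter.Tendsto (fun n => expNegE (∫⁻ x, (1 - expNegE (F n x)) ∂ν))
      Filter.atTop (nhds (expNegE (∫⁻ x, (1 - expNegE (f x)) ∂ν))) := by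
    refine (continuous_expNegE.tendsto _).comp ?_
    refine lintegral_tendsto_of_tendsto_of_monotone (fun n => by
      have := (F n).measurable
      fun_prop) (ae_of_all _ fun x => ?_) (ae_of_all _ fun x => ?_)
    · intro n m hnm
      exact tsub_le_tsub_left (expNegE_antitone (hmono x hnm)) _
    · refine ENNReal.Tendsto.sub tendsto_const_nhds ?_ (Or.inl ENNReal.one_ne_top)
      refine (continuous_expNegE.tendsto _).comp ?_
      rw [← hsup x]
      exact tendsto_atTop_iSup (hmono x)
  simp_rw [heq] at hL
  exact tendsto_nhds_unique hL hR

end Laplace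

/-! ### Averaging over conditionally independent marks -/

section Marking

variable {Ω S T : Type*} [MeasurableSpace Ω] [MeasurableSpace S] [MeasurableSpace T]
  {μ : Measure Ω} {X : Ω → S} {mark : ℕ → Ω → T} {κ : ℕ → S → Measure T}

lemma measurable_lintegral_of_isProbabilityMeasure {κ : S → Measure T} (hκ : Measurable κ)
    [∀ x, IsProbabilityMeasure (κ x)] {f : S × T → ℝ≥0∞} (hf : Measurable f) :
    Measurable fun x => ∫⁻ t, f (x, t) ∂κ x := by
  have : IsMarkovKernel (⟨κ, hκ⟩ : Kernel S T) := ⟨fun x => by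
    change IsProbabilityMeasure (κ x); infer_instance⟩
  exact Measurable.lintegral_kernel_prod_right' (κ := (⟨κ, hκ⟩ : Kernel S T)) hf

lemma measurable_measurePi {n : ℕ} {κ : Fin n → S → Measure T}
    (hκ : ∀ i, Measurable (κ i)) [∀ i x, IsProbabilityMeasure (κ i x)] :
    Measurable fun x => Measure.pi fun i => κ i x := by
  refine Measurable.measure_of_isPiSystem_of_isProbabilityMeasure generateFrom_pi.symm
    isPiSystem_pi ?_
  rintro _ ⟨B, hB, rfl⟩
  simp only [Measure.pi_pi]
  exact Finset.measurable_prod _ fun i _ =>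
    (Measure.measurable_coe (hB i (Set.mem_univ i))).comp (hκ i)

variable [IsProbabilityMeasure μ] [∀ i x, IsProbabilityMeasure (κ i x)]

/-- The joint law of `X` and the first `n` marks. -/
lemma IsIndependentMarking.map_eq_compProd (h : IsIndependentMarking μ X mark κ)
    (hX : Measurable X) (hκ : ∀ i, Measurable (κ i)) (n : ℕ) :
    μ.map (fun ω => (X ω, fun i : Fin n => mark i ω)) =
      (μ.map X).compProd
        ⟨fun x => Measure.pi fun i : Fin n => κ i x, measurable_measurePi fun i => hκ i⟩ := by
  have hm : Measurable fun ω => (X ω, fun i : Fin n => mark i ω) :=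
    hX.prodMk (measurable_pi_lambda _ fun i => h.1 i)
  have : IsProbabilityMeasure (μ.map X) := Measure.isProbabilityMeasure_map hX.aemeasurable
  have : IsProbabilityMeasure (μ.map (fun ω => (X ω, fun i : Fin n => mark i ω))) :=
    Measure.isProbabilityMeasure_map hm.aemeasurable
  set K : Kernel S (Fin n → T) :=
    ⟨fun x => Measure.pi fun i : Fin n => κ i x, measurable_measurePi fun i => hκ i⟩ with hK
  have hKx : ∀ x, K x = Measure.pi fun i : Fin n => κ i x := fun x => rfl
  have : IsMarkovKernel K := ⟨fun x => by rw [hKx]; infer_instance⟩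
  -- Both sides are probability measures, and the marking hypothesis says that they agree on the
  -- π-system of boxes A × ∏ B i.
  refine ext_of_generate_finite
    (Set.image2 (· ×ˢ ·) {s : Set S | MeasurableSet s}
      (Set.pi Set.univ '' Set.pi Set.univ fun _ : Fin n => {t : Set T | MeasurableSet t}))
    ?_ (MeasurableSpace.isPiSystem_measurableSet.prod isPiSystem_pi) ?_ (by simp)
  · refine (generateFrom_eq_prod MeasurableSpace.generateFrom_measurableSet generateFrom_pi
      isCountablySpanning_measurableSet
      (IsCountablySpanning.pi fun _ => isCountablySpanning_measurableSet)).symm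
  · rintro _ ⟨A, hA, _, ⟨B, hB, rfl⟩, rfl⟩
    have hB' : ∀ i, MeasurableSet (B i) := fun i => hB i (Set.mem_univ i)
    have hBm : MeasurableSet (Set.univ.pi B) := MeasurableSet.univ_pi hB'
    have hA' : MeasurableSet A := hA
    rw [Measure.map_apply hm (hA'.prod hBm), Measure.compProd_apply_prod hA' hBm]
    have e : (fun ω => (X ω, fun i : Fin n => mark i ω)) ⁻¹' A ×ˢ Set.univ.pi B =
        {ω | X ω ∈ A ∧ ∀ i : Fin n, mark i ω ∈ B i} := by
      ext ω; simp
    rw [e, h.2 n A B hA' hB', setLIntegral_map hA' (K.measurable_coe hBm) hX]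
    simp_rw [hKx, Measure.pi_pi]

/-- Under the conditional law of the marks, a product measure, the integral of a product of one-mark
functions factorises. -/
lemma IsIndependentMarking.setLIntegral_expNegE_sum (h : IsIndependentMarking μ X mark κ)
    (hX : Measurable X) (hκ : ∀ i, Measurable (κ i)) {w : ℕ → S → T → ℝ≥0∞}
    (hw : ∀ i, Measurable (Function.uncurry (w i))) {c : S → ℝ≥0∞} (hc : Measurable c)
    {A : Set S} (hA : MeasurableSet A) (n : ℕ) :
    ∫⁻ ω in X ⁻¹' A, expNegE (c (X ω) + ∑ i : Fin n, w i (X ω) (mark i ω)) ∂μ =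
      ∫⁻ ω in X ⁻¹' A, expNegE (c (X ω)) *
        ∏ i : Fin n, ∫⁻ t, expNegE (w i (X ω) t) ∂κ i (X ω) ∂μ := by
  have hm : Measurable fun ω => (X ω, fun i : Fin n => mark i ω) :=
    hX.prodMk (measurable_pi_lambda _ fun i => h.1 i)
  have : IsProbabilityMeasure (μ.map X) := Measure.isProbabilityMeasure_map hX.aemeasurable
  set K : Kernel S (Fin n → T) :=
    ⟨fun x => Measure.pi fun i : Fin n => κ i x, measurable_measurePi fun i => hκ i⟩ with hK
  have hKx : ∀ x, K x = Measure.pi fun i : Fin n => κ i x := fun x => rfl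
  have : IsMarkovKernel K := ⟨fun x => by rw [hKx]; infer_instance⟩
  have hf : Measurable fun q : S × (Fin n → T) =>
      expNegE (c q.1) * ∏ i : Fin n, expNegE (w i q.1 (q.2 i)) := by
    refine (measurable_expNegE.comp (hc.comp measurable_fst)).mul ?_
    refine Finset.measurable_prod _ fun i _ => measurable_expNegE.comp ?_
    exact (hw i).comp (measurable_fst.prodMk ((measurable_pi_apply i).comp measurable_snd))
  have hpi : ∀ x, ∫⁻ t, expNegE (c x) * ∏ i : Fin n, expNegE (w i x (t i)) ∂K x =
      expNegE (c x) * ∏ i : Fin n, ∫⁻ t, expNegE (w i x t) ∂κ i x := by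
    intro x
    have hg : ∀ i : Fin n, Measurable fun t => expNegE (w i x t) := fun i =>
      measurable_expNegE.comp ((hw i).comp measurable_prodMk_left)
    rw [lintegral_const_mul' _ _ (expNegE_ne_top _), hKx, lintegral_prod_eq_prod_lintegral_of_indepFun Finset.univ _
      (iIndepFun_pi fun i => (hg i).aemeasurable)
      (fun i => (hg i).comp (measurable_pi_apply i))]
    refine congrArg _ (Finset.prod_congr rfl fun i _ => ?_)
    exact (measurePreserving_eval (fun i : Fin n => κ i x) i).lintegral_comp (hg i)
  have h1 := setLIntegral_map (μ := μ) (hA.prod MeasurableSet.univ) hf hm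
  rw [h.map_eq_compProd hX hκ n, Measure.setLIntegral_compProd hf hA MeasurableSet.univ] at h1
  simp_rw [Measure.restrict_univ] at h1
  rw [← hK] at h1
  simp_rw [hpi] at h1
  have e : (fun ω => (X ω, fun i : Fin n => mark i ω)) ⁻¹' A ×ˢ Set.univ = X ⁻¹' A := by
    ext ω; simp
  rw [e] at h1
  simp_rw [expNegE_add, expNegE_sum]
  rw [← h1, setLIntegral_map hA ?_ hX]
  have := Measurable.lintegral_kernel_prod_right (κ := K) 
    (f := fun x t => expNegE (c x) * ∏ i : Fin n, expNegE (w i x (t i))) hf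
  simpa only [hpi] using this

/-- Averaging over the marks inside a Laplace transform. -/
theorem IsIndependentMarking.setLIntegral_expNegE_tsum (h : IsIndependentMarking μ X mark κ)
    (hX : Measurable X) (hκ : ∀ i, Measurable (κ i)) {w : ℕ → S → T → ℝ≥0∞}
    (hw : ∀ i, Measurable (Function.uncurry (w i))) {c : S → ℝ≥0∞} (hc : Measurable c)
    {A : Set S} (hA : MeasurableSet A) :
    ∫⁻ ω in X ⁻¹' A, expNegE (c (X ω) + ∑' i, w i (X ω) (mark i ω)) ∂μ =
      ∫⁻ ω in X ⁻¹' A,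
        expNegE (c (X ω) + ∑' i, negLogE (∫⁻ t, expNegE (w i (X ω) t) ∂κ i (X ω))) ∂μ := by
  -- This bound makes each averaged factor the exponential of minus its negative logarithm, so the
  -- finite product becomes a sum in the exponent and the same limit argument serves both sides.
  have hle : ∀ i x, ∫⁻ t, expNegE (w i x t) ∂κ i x ≤ 1 := fun i x =>
    (lintegral_mono fun t => expNegE_le_one _).trans (by simp)
  have hlim : ∀ a : ℕ → Ω → ℝ≥0∞, (∀ i, Measurable (a i)) →
      Filter.Tendsto (fun n => ∫⁻ ω in X ⁻¹' A, expNegE (c (X ω) + ∑ i : Fin n, a i ω) ∂μ) Filter.atTop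
        (nhds (∫⁻ ω in X ⁻¹' A, expNegE (c (X ω) + ∑' i, a i ω) ∂μ)) := by
    intro a ha
    refine tendsto_lintegral_of_dominated_convergence (fun _ => 1)
      (fun n => measurable_expNegE.comp
        ((hc.comp hX).add (Finset.measurable_sum _ fun i _ => ha i)))
      (fun n => ae_of_all _ fun ω => expNegE_le_one _)
      (by simp) (ae_of_all _ fun ω => ?_)
    refine (continuous_expNegE.tendsto _).comp (Filter.Tendsto.add tendsto_const_nhds ?_)
    simp_rw [Fin.sum_univ_eq_sum_range (fun i => a i ω)]
    exact ENNReal.summable.hasSum.tendsto_sum_nat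
  have hint : ∀ i, Measurable fun x => ∫⁻ t, expNegE (w i x t) ∂κ i x := fun i =>
    measurable_lintegral_of_isProbabilityMeasure (hκ i) (measurable_expNegE.comp (hw i))
  refine tendsto_nhds_unique
    (hlim (fun i ω => w i (X ω) (mark i ω)) fun i => (hw i).comp (hX.prodMk (h.1 i))) ?_
  have h2 := hlim (fun i ω => negLogE (∫⁻ t, expNegE (w i (X ω) t) ∂κ i (X ω)))
    (fun i => measurable_negLogE.comp ((hint i).comp hX))
  refine h2.congr fun n => ?_
  rw [h.setLIntegral_expNegE_sum hX hκ hw hc hA n]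
  simp_rw [expNegE_add, expNegE_sum, expNegE_negLogE (hle _ _)]

end Marking

end MmWave

/-! ### The exponential law -/

section Exponential

lemma expMeasure_eq_withDensity (r : ℝ) : expMeasure r = volume.withDensity (exponentialPDF r) := rfl

instance instNullSingletonClassExpMeasure (r : ℝ) : NullSingletonClass (expMeasure r) := by
  rw [expMeasure_eq_withDensity]; infer_instance

lemma expMeasure_one_Ioi {t : ℝ} (ht : 0 ≤ t) :
    expMeasure 1 (Set.Ioi t) = ENNReal.ofReal (Real.exp (-t)) := by
  have := isProbabilityMeasure_expMeasure one_pos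
  have h : expMeasure 1 (Set.Iic t) = ENNReal.ofReal (1 - Real.exp (-t)) := by
    rw [← ofReal_cdf, cdf_expMeasure_eq one_pos, if_pos ht, one_mul]
  rw [← Set.compl_Iic, prob_compl_eq_one_sub measurableSet_Iic, h, ← ENNReal.ofReal_one,
    ← ENNReal.ofReal_sub _ (by simpa using ht)]
  congr 1
  ring

lemma ae_expMeasure_nonneg : ∀ᵐ x ∂expMeasure 1, 0 ≤ x := by
  have := isProbabilityMeasure_expMeasure one_pos
  have h := expMeasure_one_Ioi le_rfl
  rw [neg_zero, Real.exp_zero, ENNReal.ofReal_one] at h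
  have h' := (prob_compl_eq_zero_iff measurableSet_Ioi).2 h
  filter_upwards [measure_eq_zero_iff_ae_notMem.1 h'] with x hx
  simp only [Set.compl_Ioi, Set.mem_Iic, not_le] at hx
  exact hx.le

lemma expMeasure_one_lt_ofReal (J : ℝ≥0∞) :
    expMeasure 1 {x | J < ENNReal.ofReal x} = expNegE J := by
  by_cases hJ : J = ⊤
  · simp [hJ]
  · have e : {x : ℝ | J < ENNReal.ofReal x} = Set.Ioi J.toReal := by
      ext x
      exact ENNReal.lt_ofReal_iff_toReal_lt hJ
    rw [e, expMeasure_one_Ioi ENNReal.toReal_nonneg, ← expNegE_ofReal ENNReal.toReal_nonneg,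
      ENNReal.ofReal_toReal hJ]

/-- The exponential law charges neither the level J nor the negative half-line, where
`ENNReal.ofReal` would collapse values to zero. -/
lemma expMeasure_one_le_ofReal (J : ℝ≥0∞) :
    expMeasure 1 {x | J ≤ ENNReal.ofReal x} = expNegE J := by
  rw [← expMeasure_one_lt_ofReal]
  refine measure_congr ?_
  have h0 : ∀ᵐ x ∂expMeasure 1, x ∉ ({J.toReal} : Set ℝ) :=
    measure_eq_zero_iff_ae_notMem.1 (measure_singleton _)
  filter_upwards [h0, ae_expMeasure_nonneg] with x hx hx0
  refine propext ⟨fun h => lt_of_le_of_ne h fun h' => hx ?_, le_of_lt⟩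
  simp [h', hx0]

/-- Tilting the density of rate 1 by exp(-c x) gives 1/(1 + c) times the density of rate 1 + c. -/
lemma lintegral_expNegE_expMeasure {c : ℝ} (hc : 0 ≤ c) :
    ∫⁻ x, expNegE (ENNReal.ofReal (c * x)) ∂expMeasure 1 = ENNReal.ofReal (1 / (1 + c)) := by
  rw [expMeasure_eq_withDensity, lintegral_withDensity_eq_lintegral_mul _
    (by exact (measurable_exponentialPDFReal 1).ennreal_ofReal) (by fun_prop)]
  have : ∀ x, (exponentialPDF 1 * fun x => expNegE (ENNReal.ofReal (c * x))) x =
      ENNReal.ofReal (1 / (1 + c)) * exponentialPDF (1 + c) x := by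
    intro x
    rw [Pi.mul_apply]
    rcases lt_or_ge x 0 with hx | hx
    · rw [exponentialPDF_of_neg hx, exponentialPDF_of_neg hx, zero_mul, mul_zero]
    · rw [exponentialPDF_of_nonneg hx, exponentialPDF_of_nonneg hx,
        expNegE_ofReal (mul_nonneg hc hx), ← ENNReal.ofReal_mul (by positivity),
        ← ENNReal.ofReal_mul (by positivity), ← mul_assoc, one_mul, one_div_mul_cancel (by positivity),
        one_mul, one_mul, ← Real.exp_add]
      congr 2
      ring
  simp_rw [this]
  rw [lintegral_const_mul _ (by exact (measurable_exponentialPDFReal _).ennreal_ofReal),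
    lintegral_exponentialPDF_eq_one (by positivity), mul_one]

lemma lintegral_one_sub_expNegE_expMeasure {c : ℝ} (hc : 0 ≤ c) :
    ∫⁻ x, (1 - expNegE (ENNReal.ofReal (c * x))) ∂expMeasure 1 = ENNReal.ofReal (c / (1 + c)) := by
  have := isProbabilityMeasure_expMeasure one_pos
  rw [lintegral_sub (by fun_prop) (by rw [lintegral_expNegE_expMeasure hc]; simp)
    (ae_of_all _ fun x => expNegE_le_one _), lintegral_expNegE_expMeasure hc]
  simp only [lintegral_one, measure_univ]
  rw [← ENNReal.ofReal_one, ← ENNReal.ofReal_sub _ (by positivity)]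
  congr 1
  field_simp
  ring

end Exponential

namespace MmWave

/-! ### Angles, sectors and beams -/

section Geometry

lemma measurable_polarAngle : Measurable polarAngle := by
  have : polarAngle = fun x : ℂ => x.arg - ⌊x.arg / (2 * Real.pi)⌋ * (2 * Real.pi) := by
    funext x
    rw [polarAngle, toIcoMod, toIcoDiv_eq_floor, sub_zero, zsmul_eq_mul]
  rw [this]
  fun_prop

lemma polarAngle_mem (x : ℂ) : polarAngle x ∈ Set.Ico 0 (2 * Real.pi) := by
  simpa [polarAngle] using toIcoMod_mem_Ico Real.two_pi_pos 0 x.arg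

/-- Polar coordinates use angles in (-π, π), beams use [0, 2π). Shifting the negative half by 2π
recovers [a, b) except possibly the point π. -/
lemma volume_toIcoMod_mem_Ico {a b : ℝ} (ha : 0 ≤ a) (hb : b ≤ 2 * Real.pi) :
    volume (Set.Ioo (-Real.pi) Real.pi ∩
      {θ | toIcoMod Real.two_pi_pos 0 θ ∈ Set.Ico a b}) = ENNReal.ofReal (b - a) := by
  have hpi := Real.pi_pos
  have h1 : ∀ θ ∈ Set.Ico 0 Real.pi, toIcoMod Real.two_pi_pos 0 θ = θ := fun θ hθ =>
    (toIcoMod_eq_self _).2 ⟨hθ.1, by linarith [hθ.2]⟩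
  have h2 : ∀ θ ∈ Set.Ioo (-Real.pi) 0, toIcoMod Real.two_pi_pos 0 θ = θ + 2 * Real.pi := by
    intro θ hθ
    rw [← toIcoMod_add_right]
    exact (toIcoMod_eq_self _).2 ⟨by linarith [hθ.1], by linarith [hθ.2]⟩
  have e : Set.Ioo (-Real.pi) Real.pi ∩ {θ | toIcoMod Real.two_pi_pos 0 θ ∈ Set.Ico a b} =
      (Set.Ico 0 Real.pi ∩ Set.Ico a b) ∪
        (fun θ => θ + 2 * Real.pi) ⁻¹' (Set.Ioo Real.pi (2 * Real.pi) ∩ Set.Ico a b) := by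
    ext θ
    simp only [Set.mem_inter_iff, Set.mem_union, Set.mem_preimage, Set.mem_ofPred_eq]
    constructor
    · rintro ⟨⟨h3, h4⟩, h5⟩
      rcases lt_or_ge θ 0 with h | h
      · right
        rw [h2 θ ⟨h3, h⟩] at h5
        exact ⟨⟨by linarith, by linarith⟩, h5⟩
      · left
        rw [h1 θ ⟨h, h4⟩] at h5
        exact ⟨⟨h, h4⟩, h5⟩
    · rintro (⟨h3, h4⟩ | ⟨h3, h4⟩)
      · exact ⟨⟨by linarith [h3.1], h3.2⟩, by rwa [h1 θ h3]⟩
      · have : θ ∈ Set.Ioo (-Real.pi) 0 := ⟨by linarith [h3.1], by linarith [h3.2]⟩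
        exact ⟨⟨this.1, by linarith [this.2]⟩, by rwa [h2 θ this]⟩
  rw [e, measure_union _ ((measurable_add_const _) (measurableSet_Ioo.inter measurableSet_Ico)),
    measure_preimage_add_right, ← measure_union _ (measurableSet_Ioo.inter measurableSet_Ico)]
  · have : (Set.Ico 0 Real.pi ∩ Set.Ico a b) ∪ (Set.Ioo Real.pi (2 * Real.pi) ∩ Set.Ico a b) =
        Set.Ico a b \ {Real.pi} := by
      ext θ
      simp only [Set.mem_union, Set.mem_inter_iff, Set.mem_sdiff, Set.mem_singleton_iff,
        Set.mem_Ico, Set.mem_Ioo]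
      constructor
      · rintro (⟨h3, h4⟩ | ⟨h3, h4⟩)
        · exact ⟨h4, h3.2.ne⟩
        · exact ⟨h4, h3.1.ne'⟩
      · rintro ⟨h3, h4⟩
        rcases lt_or_gt_of_ne h4 with h | h
        · exact Or.inl ⟨⟨ha.trans h3.1, h⟩, h3⟩
        · exact Or.inr ⟨⟨h, h3.2.trans_le hb⟩, h3⟩
    rw [this, measure_sdiff_null (measure_singleton _), Real.volume_Ico]
  · refine Set.disjoint_left.2 fun θ h3 h4 => ?_
    exact lt_asymm h3.1.2 h4.1.1
  · refine Set.disjoint_left.2 fun θ h3 h4 => ?_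
    have h5 := h3.1.1
    have h6 := h4.1.2
    linarith

/-- Integration of a radial function over a sector in polar coordinates. -/
lemma lintegral_sector_zero {a b : ℝ} (ha : 0 ≤ a) (hb : b ≤ 2 * Real.pi)
    {q : ℝ → ℝ≥0∞} (hq : Measurable q) :
    ∫⁻ x : ℂ, (if polarAngle x ∈ Set.Ico a b then q ‖x‖ else 0) =
      ENNReal.ofReal (b - a) * ∫⁻ r in Set.Ioi (0 : ℝ), ENNReal.ofReal r * q r := by
  classical
  set S : Set ℝ := {θ | toIcoMod Real.two_pi_pos 0 θ ∈ Set.Ico a b} with hS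
  have hSm : MeasurableSet S := by
    have : Measurable fun θ : ℝ => toIcoMod Real.two_pi_pos 0 θ := by
      have e : (fun θ : ℝ => toIcoMod Real.two_pi_pos 0 θ) =
          fun θ : ℝ => θ - ⌊θ / (2 * Real.pi)⌋ * (2 * Real.pi) := by
        funext x
        rw [toIcoMod, toIcoDiv_eq_floor, sub_zero, zsmul_eq_mul]
      rw [e]; fun_prop
    exact this measurableSet_Ico
  rw [← Complex.lintegral_comp_polarCoord_symm, polarCoord_target]
  have hcongr : ∀ p ∈ Set.Ioi (0 : ℝ) ×ˢ Set.Ioo (-Real.pi) Real.pi,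
      ENNReal.ofReal p.1 • (if polarAngle (Complex.polarCoord.symm p) ∈ Set.Ico a b
        then q ‖Complex.polarCoord.symm p‖ else 0) =
      (ENNReal.ofReal p.1 * q p.1) * S.indicator 1 p.2 := by
    rintro ⟨r, θ⟩ ⟨hr, hθ⟩
    have hr' : 0 < r := hr
    have h1 : ‖Complex.polarCoord.symm (r, θ)‖ = r := by
      rw [Complex.norm_polarCoord_symm, abs_of_pos hr']
    have h2 : (Complex.polarCoord.symm (r, θ)).arg = θ := by
      have := Complex.polarCoord.right_inv (x := (r, θ)) ⟨hr, hθ⟩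
      simpa [Complex.polarCoord_apply] using congrArg Prod.snd this
    rw [h1, polarAngle, h2, smul_eq_mul]
    by_cases h : toIcoMod Real.two_pi_pos 0 θ ∈ Set.Ico a b
    · have h' : θ ∈ S := h
      rw [Set.indicator_of_mem h', if_pos h, Pi.one_apply, mul_one]
    · have h' : θ ∉ S := h
      rw [Set.indicator_of_notMem h', if_neg h, mul_zero, mul_zero]
  rw [setLIntegral_congr_fun (measurableSet_Ioi.prod measurableSet_Ioo) hcongr,
    Measure.volume_eq_prod, ← Measure.prod_restrict,
    lintegral_prod_mul (f := fun r => ENNReal.ofReal r * q r) (g := S.indicator 1) (by fun_prop)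
      (measurable_one.indicator hSm).aemeasurable,
    lintegral_indicator_one hSm, Measure.restrict_apply hSm, Set.inter_comm, hS,
    volume_toIcoMod_mem_Ico ha hb, mul_comm]

lemma mem_beamArea {u x : ℂ} {n : ℕ} {j : Fin n} :
    x ∈ beamArea u n j ↔ polarAngle (x - u) ∈
      Set.Ico (2 * Real.pi * (j : ℝ) / n) (2 * Real.pi * ((j : ℝ) + 1) / n) := Iff.rfl

/-- The beams of a station cover every direction exactly once. -/
lemma existsUnique_mem_beamArea (u x : ℂ) {n : ℕ} (hn : 0 < n) :
    ∃! j : Fin n, x ∈ beamArea u n j := by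
  have hpi := Real.two_pi_pos
  have hn' : (0 : ℝ) < n := Nat.cast_pos.2 hn
  have hφ := polarAngle_mem (x - u)
  simp only [mem_beamArea]
  set φ := polarAngle (x - u)
  -- The beam containing the angle φ has index ⌊φ n / 2π⌋.
  have hiff : ∀ j : ℕ, φ ∈ Set.Ico (2 * Real.pi * (j : ℝ) / n) (2 * Real.pi * ((j : ℝ) + 1) / n) ↔
      ⌊φ * n / (2 * Real.pi)⌋₊ = j := by
    intro j
    rw [Nat.floor_eq_iff (by have := hφ.1; positivity), Set.mem_Ico, div_le_iff₀ hn',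
      lt_div_iff₀ hn', le_div_iff₀ hpi, div_lt_iff₀ hpi, mul_comm (j : ℝ),
      mul_comm ((j : ℝ) + 1)]
  have hlt : ⌊φ * n / (2 * Real.pi)⌋₊ < n := by
    rw [Nat.floor_lt (by have := hφ.1; positivity), div_lt_iff₀ hpi, mul_comm]
    exact mul_lt_mul_of_pos_left hφ.2 hn'
  refine ⟨⟨_, hlt⟩, (hiff _).2 rfl, fun j hj => ?_⟩
  exact Fin.ext ((hiff j).1 hj).symm

open Classical in
lemma sum_ite_mem_beamArea (u x : ℂ) {n : ℕ} (hn : 0 < n) (c d : ℝ≥0∞) :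
    ∑ j : Fin n, (if x ∈ beamArea u n j then c else d) = c + (n - 1 : ℕ) * d := by
  obtain ⟨j, hj, huniq⟩ := existsUnique_mem_beamArea u x hn
  rw [← Finset.add_sum_erase _ _ (Finset.mem_univ j), if_pos hj, Finset.sum_congr rfl
    (g := fun _ => d) (fun k hk => if_neg fun h => (Finset.mem_erase.1 hk).1 (huniq k h)),
    Finset.sum_const, Finset.card_erase_of_mem (Finset.mem_univ j), Finset.card_univ,
    Fintype.card_fin, nsmul_eq_mul]

lemma beam_bounds {n : ℕ} (j : Fin n) : 0 ≤ 2 * Real.pi * (j : ℝ) / n ∧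
    2 * Real.pi * ((j : ℝ) + 1) / n ≤ 2 * Real.pi ∧
    2 * Real.pi * ((j : ℝ) + 1) / n - 2 * Real.pi * (j : ℝ) / n = 2 * Real.pi / n := by
  have hpi := Real.two_pi_pos
  have hn : (0 : ℝ) < n := Nat.cast_pos.2 j.pos
  have hj : (j : ℝ) + 1 ≤ n := by exact_mod_cast j.2
  refine ⟨by positivity, ?_, by ring⟩
  rw [div_le_iff₀ hn]
  exact mul_le_mul_of_nonneg_left hj hpi.le

open Classical in
lemma lintegral_beamArea (u : ℂ) {n : ℕ} (j : Fin n) {q : ℝ → ℝ≥0∞} (hq : Measurable q) :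
    ∫⁻ x : ℂ, (if x ∈ beamArea u n j then q ‖x - u‖ else 0) =
      ENNReal.ofReal (2 * Real.pi / n) * ∫⁻ r in Set.Ioi (0 : ℝ), ENNReal.ofReal r * q r := by
  obtain ⟨h1, h2, h3⟩ := beam_bounds j
  rw [← h3, ← lintegral_sector_zero h1 h2 hq, 
    ← lintegral_sub_right_eq_self (fun x => if polarAngle x ∈ _ then q ‖x‖ else 0) u]
  refine lintegral_congr fun x => ?_
  congr 1

open Classical in
-- The transmitters x whose beam j covers u form the image of a sector under x ↦ u - x, which
-- preserves area and distances to the apex.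
lemma lintegral_beamArea_reverse (u : ℂ) {n : ℕ} (j : Fin n) {q : ℝ → ℝ≥0∞} (hq : Measurable q) :
    ∫⁻ x : ℂ, (if u ∈ beamArea x n j then q ‖x - u‖ else 0) =
      ENNReal.ofReal (2 * Real.pi / n) * ∫⁻ r in Set.Ioi (0 : ℝ), ENNReal.ofReal r * q r := by
  obtain ⟨h1, h2, h3⟩ := beam_bounds j
  rw [← h3, ← lintegral_sector_zero h1 h2 hq, 
    ← lintegral_sub_left_eq_self (fun x => if polarAngle x ∈ _ then q ‖x‖ else 0) u]
  refine lintegral_congr fun x => ?_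
  rw [norm_sub_rev]
  congr 1

lemma measurableSet_mem_beamArea (n : ℕ) :
    MeasurableSet {a : ℂ × ℂ × Fin n | a.2.1 ∈ beamArea a.1 n a.2.2} := by
  have hm : Measurable fun a : ℂ × ℂ × Fin n => polarAngle (a.2.1 - a.1) :=
    measurable_polarAngle.comp (by fun_prop)
  have hj : Measurable fun a : ℂ × ℂ × Fin n => ((a.2.2 : ℕ) : ℝ) :=
    (measurable_from_top (f := fun j : Fin n => ((j : ℕ) : ℝ))).comp (by fun_prop)
  refine (measurableSet_le (f := fun a : ℂ × ℂ × Fin n => 2 * Real.pi * ((a.2.2 : ℕ) : ℝ) / n)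
    (by fun_prop) hm).inter (measurableSet_lt hm
      (g := fun a : ℂ × ℂ × Fin n => 2 * Real.pi * (((a.2.2 : ℕ) : ℝ) + 1) / n) (by fun_prop))

end Geometry

/-! ### The law of a user's mark -/

section MarkLaw

lemma lintegral_uniformOn_univ {α : Type*} [Fintype α] [MeasurableSpace α]
    [MeasurableSingletonClass α] (f : α → ℝ≥0∞) :
    ∫⁻ a, f a ∂uniformOn (Set.univ : Set α) = (Fintype.card α : ℝ≥0∞)⁻¹ * ∑ a, f a := by
  rw [uniformOn, ProbabilityTheory.cond, Measure.restrict_univ, lintegral_smul_measure, lintegral_count,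
    tsum_fintype, Measure.count_univ, ENat.card_eq_coe_fintype_card, smul_eq_mul]
  simp

variable (P : Params) (p : Protocol)

instance instIsProbabilityMeasureUniformBeam :
    IsProbabilityMeasure (uniformOn (Set.univ : Set (Fin P.N))) :=
  have : Nonempty (Fin P.N) := ⟨⟨0, P.N_pos⟩⟩
  isProbabilityMeasure_uniformOn Set.finite_univ Set.univ_nonempty

instance instIsProbabilityMeasureUniformPreamble :
    IsProbabilityMeasure (uniformOn (Set.univ : Set (Fin P.NPA))) :=
  have : Nonempty (Fin P.NPA) := ⟨⟨0, P.NPA_pos⟩⟩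
  isProbabilityMeasure_uniformOn Set.finite_univ Set.univ_nonempty

instance instIsProbabilityMeasureExpMeasureOne : IsProbabilityMeasure (expMeasure 1) :=
  isProbabilityMeasure_expMeasure one_pos

instance instIsProbabilityMeasureBeamLaw (b : Fin P.N) :
    IsProbabilityMeasure (beamLaw P p b) := by
  cases p <;> simp only [beamLaw] <;> infer_instance

/-- Law of the mark of a user given whether its link to the tagged BS is LOS. -/
noncomputable def markLawGiven (b : Fin P.N) (los : Bool) : Measure (UserMark P) :=
  (uniformOn (Set.univ : Set (Fin P.NPA))).prod
    ((Measure.dirac los).prod ((beamLaw P p b).prod (expMeasure 1)))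

instance instIsProbabilityMeasureMarkLawGiven (b : Fin P.N) (los : Bool) :
    IsProbabilityMeasure (markLawGiven P p b los) := by
  unfold markLawGiven; infer_instance

/-- Only the two mixture weights depend on the distance; total mass and measurability in r are read
off from them. -/
lemma markLaw_eq (b : Fin P.N) (r : ℝ) :
    markLaw P p b r = ENNReal.ofReal (P.h r) • markLawGiven P p b true +
      ENNReal.ofReal (1 - P.h r) • markLawGiven P p b false := by
  rw [markLaw, losLaw, Measure.add_prod, Measure.prod_smul_left, Measure.prod_smul_left,
    Measure.prod_add, Measure.prod_smul_right, Measure.prod_smul_right]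
  rfl

lemma isProbabilityMeasure_markLaw (b : Fin P.N) {r : ℝ} (hr : 0 ≤ r) :
    IsProbabilityMeasure (markLaw P p b r) := by
  refine ⟨?_⟩
  rw [markLaw_eq, Measure.add_apply, Measure.smul_apply, Measure.smul_apply, measure_univ,
    measure_univ, smul_eq_mul, smul_eq_mul, mul_one, mul_one,
    ← ENNReal.ofReal_add (P.h_nonneg r hr) (sub_nonneg.2 (P.h_le_one r hr))]
  simp

lemma measurable_markLaw : Measurable fun q : Fin P.N × ℝ => markLaw P p q.1 q.2 := by
  refine measurable_from_prod_countable_right fun b => ?_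
  simp only [markLaw_eq]
  refine Measure.measurable_of_measurable_coe _ fun s hs => ?_
  have := P.h_measurable
  simp only [Measure.add_apply, Measure.smul_apply, smul_eq_mul]
  fun_prop

lemma lintegral_markLawGiven (b : Fin P.N) (los : Bool) {f : UserMark P → ℝ≥0∞}
    (hf : Measurable f) :
    ∫⁻ m, f m ∂markLawGiven P p b los =
      ∫⁻ c, ∫⁻ d, ∫⁻ x, f (c, los, d, x) ∂expMeasure 1 ∂beamLaw P p b
        ∂uniformOn (Set.univ : Set (Fin P.NPA)) := by
  rw [markLawGiven, lintegral_prod _ hf.aemeasurable]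
  refine lintegral_congr fun c => ?_
  have hc : Measurable fun q => f (c, q) := hf.comp measurable_prodMk_left
  rw [lintegral_prod _ hc.aemeasurable, lintegral_dirac' _ hc.lintegral_prod_right']
  have hc' : Measurable fun q => f (c, los, q) := hc.comp measurable_prodMk_left
  rw [lintegral_prod _ hc'.aemeasurable]

end MarkLaw

/-! ### Antenna gains and path loss -/

section Gains

variable (P : Params) (p : Protocol)

lemma two_pi_div_N : 2 ≤ P.N → 2 * Real.pi / (P.N : ℝ) < 2 * Real.pi := fun h => by
  have : (2 : ℝ) ≤ P.N := by exact_mod_cast h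
  rw [div_lt_iff₀ (by linarith)]
  nlinarith [Real.two_pi_pos]

lemma frontBack_pos {θ : ℝ} (h : θ < 2 * Real.pi) : 0 < frontBack P θ := by
  have := P.C₀_pos
  have := Real.two_pi_pos
  have : 0 < 2 * Real.pi - θ := by linarith
  unfold frontBack
  positivity

lemma mainGain_pos : 0 < mainGain P (2 * Real.pi / (P.N : ℝ)) := by
  have hN : (0 : ℝ) < P.N := Nat.cast_pos.2 P.N_pos
  have hpi := Real.pi_pos
  unfold mainGain
  split_ifs with h
  · exact one_pos
  · have h2 : 2 ≤ P.N := by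
      by_contra h2
      have : P.N = 1 := by have := P.N_pos; omega
      exact h (by simp [this])
    have := frontBack_pos P (two_pi_div_N P h2)
    positivity

lemma sideGain_nonneg : 0 ≤ sideGain P (2 * Real.pi / (P.N : ℝ)) := by
  have hpi := Real.pi_pos
  by_cases h2 : 2 ≤ P.N
  · have h := two_pi_div_N P h2
    have := frontBack_pos P h
    have : 0 < 2 * Real.pi - 2 * Real.pi / (P.N : ℝ) := by linarith
    unfold sideGain
    positivity
  · have : P.N = 1 := by have := P.N_pos; omega
    -- For N = 1 the formula divides by 2π - 2π = 0, and the convention for division by zero makes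
    -- the gain zero.
    simp [sideGain, this]

lemma pathLoss_pos (los : Bool) {r : ℝ} (hr : 0 < r) : 0 < pathLoss P los r := by
  have := P.β_pos
  unfold pathLoss
  positivity

lemma pathLoss_nonneg (los : Bool) {r : ℝ} (hr : 0 ≤ r) : 0 ≤ pathLoss P los r := by
  have := P.β_pos
  unfold pathLoss
  positivity

lemma measurable_pathLoss : Measurable fun q : Bool × ℝ => pathLoss P q.1 q.2 := by
  refine measurable_from_prod_countable_right fun l => ?_
  cases l <;> simp only [pathLoss, if_true, Bool.false_eq_true, if_false] <;> fun_prop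

lemma Protocol.max_Ncs_Nra : max (p.Ncs P) (p.Nra P) = P.N := by
  have := P.N_pos
  cases p <;> simp [Protocol.Ncs, Protocol.Nra] <;> omega

end Gains

/-! ### Integration over the positions of interferers -/

section Spatial

variable (P : Params) (p : Protocol)

open Classical in
/-- Integral over the receive beam of a radial function that depends on whether the main lobe of
the transmitter covers the receiver. -/
lemma lintegral_rxBeam (u : ℂ) (j : Fin (p.Mra P)) (b : Fin P.N) {q₁ q₂ : ℝ → ℝ≥0∞}
    (h₁ : Measurable q₁) (h₂ : Measurable q₂) :
    ∫⁻ x : ℂ, (if x ∈ beamArea u (p.Mra P) j then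
        ∫⁻ d, (if u ∈ beamArea x P.N d then q₁ ‖x - u‖ else q₂ ‖x - u‖) ∂beamLaw P p b else 0) =
      ENNReal.ofReal (2 * Real.pi / (P.N * p.Mra P)) *
        (∫⁻ r in Set.Ioi (0 : ℝ), ENNReal.ofReal r * q₁ r) +
      ENNReal.ofReal ((1 - 1 / P.N) * (2 * Real.pi / p.Mra P)) *
        ∫⁻ r in Set.Ioi (0 : ℝ), ENNReal.ofReal r * q₂ r := by
  have hN : (0 : ℝ) < P.N := Nat.cast_pos.2 P.N_pos
  have hpi := Real.pi_pos
  have hm1 : ((P.N - 1 : ℕ) : ℝ≥0∞) = ENNReal.ofReal (P.N - 1) := by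
    rw [← ENNReal.ofReal_natCast, Nat.cast_sub P.N_pos, Nat.cast_one]
  have hN1 : (0 : ℝ) ≤ P.N - 1 := by
    have : (1 : ℝ) ≤ P.N := by exact_mod_cast P.N_pos
    linarith
  have hinv : ((Fintype.card (Fin P.N) : ℕ) : ℝ≥0∞)⁻¹ = ENNReal.ofReal (1 / P.N) := by
    rw [Fintype.card_fin, one_div, ENNReal.ofReal_inv_of_pos hN, ENNReal.ofReal_natCast]
  -- Exactly one of the N beams at x covers u, so a uniform beam hits u with probability 1/N
  -- wherever x is.
  have huniform : ∀ x : ℂ, ∫⁻ d, (if u ∈ beamArea x P.N d then q₁ ‖x - u‖ else q₂ ‖x - u‖)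
      ∂uniformOn (Set.univ : Set (Fin P.N)) =
      ENNReal.ofReal (1 / P.N) * q₁ ‖x - u‖ +
        ENNReal.ofReal (1 / P.N) * ENNReal.ofReal (P.N - 1) * q₂ ‖x - u‖ := by
    intro x
    rw [lintegral_uniformOn_univ, sum_ite_mem_beamArea _ _ P.N_pos, hinv, hm1, mul_add, mul_assoc]
  have huni : ∫⁻ x : ℂ, (if x ∈ beamArea u (p.Mra P) j then
        ∫⁻ d, (if u ∈ beamArea x P.N d then q₁ ‖x - u‖ else q₂ ‖x - u‖)
          ∂uniformOn (Set.univ : Set (Fin P.N)) else 0) =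
      ENNReal.ofReal (2 * Real.pi / (P.N * p.Mra P)) *
        (∫⁻ r in Set.Ioi (0 : ℝ), ENNReal.ofReal r * q₁ r) +
      ENNReal.ofReal ((1 - 1 / P.N) * (2 * Real.pi / p.Mra P)) *
        ∫⁻ r in Set.Ioi (0 : ℝ), ENNReal.ofReal r * q₂ r := by
    simp_rw [huniform]
    rw [lintegral_beamArea u j (q := fun r => ENNReal.ofReal (1 / P.N) * q₁ r +
        ENNReal.ofReal (1 / P.N) * ENNReal.ofReal (P.N - 1) * q₂ r) (by fun_prop)]
    have e : ∀ r, ENNReal.ofReal r * (ENNReal.ofReal (1 / P.N) * q₁ r +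
        ENNReal.ofReal (1 / P.N) * ENNReal.ofReal (P.N - 1) * q₂ r) =
        ENNReal.ofReal (1 / P.N) * (ENNReal.ofReal r * q₁ r) +
        ENNReal.ofReal (1 / P.N) * ENNReal.ofReal (P.N - 1) * (ENNReal.ofReal r * q₂ r) := by
      intro r; ring
    simp_rw [e]
    rw [lintegral_add_left (by fun_prop), lintegral_const_mul _ (by fun_prop),
      lintegral_const_mul _ (by fun_prop), mul_add, ← mul_assoc, ← mul_assoc,
      ← ENNReal.ofReal_mul (by positivity), ← ENNReal.ofReal_mul (by positivity),
      ← ENNReal.ofReal_mul (by positivity)]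
    congr 3 <;> field_simp
  -- With omni RX the beam b is not random and the factor 1/N has to come from space instead. As
  -- M_ra = 1, the receive beam is the whole plane.
  by_cases hp : p = .omniRX
  · subst hp
    have hall : ∀ x : ℂ, x ∈ beamArea u (Protocol.omniRX.Mra P) j := by
      intro x
      obtain ⟨k, hk, -⟩ := existsUnique_mem_beamArea u x (n := Protocol.omniRX.Mra P)
        (by simp [Protocol.Mra])
      have : Subsingleton (Fin (Protocol.omniRX.Mra P)) :=
        inferInstanceAs (Subsingleton (Fin 1))
      exact Subsingleton.elim k j ▸ hk
    have hM : ((Protocol.omniRX.Mra P : ℕ) : ℝ) = 1 := by simp [Protocol.Mra]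
    simp only [hall, if_true, beamLaw, hM, mul_one, div_one]
    -- The transmitters that miss u with beam b are split by the beam d ≠ b that would cover u: N -
    -- 1 reversed sectors, each of angle 2π/N.
    have hsplit : ∀ x : ℂ, ∫⁻ d, (if u ∈ beamArea x P.N d then q₁ ‖x - u‖ else q₂ ‖x - u‖)
        ∂Measure.dirac b = (if u ∈ beamArea x P.N b then q₁ ‖x - u‖ else 0) +
          ∑ d ∈ Finset.univ.erase b, (if u ∈ beamArea x P.N d then q₂ ‖x - u‖ else 0) := by
      intro x
      rw [lintegral_dirac]
      have hsum := sum_ite_mem_beamArea x u P.N_pos (q₂ ‖x - u‖) 0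
      rw [← Finset.add_sum_erase _ _ (Finset.mem_univ b), mul_zero, add_zero] at hsum
      split_ifs with h
      · obtain ⟨d, -, huniq⟩ := existsUnique_mem_beamArea x u P.N_pos
        rw [Finset.sum_eq_zero, add_zero]
        intro k hk
        refine if_neg fun hk' => (Finset.mem_erase.1 hk).1 ?_
        rw [huniq k hk', huniq b h]
      · rw [if_neg h, zero_add] at hsum
        rw [zero_add, hsum]
    have hmeas : ∀ (q : ℝ → ℝ≥0∞) (_ : Measurable q) (d : Fin P.N),
        Measurable fun x : ℂ => if u ∈ beamArea x P.N d then q ‖x - u‖ else 0 := by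
      intro q hq d
      refine Measurable.ite ?_ (by fun_prop) measurable_const
      have hg : Measurable fun x : ℂ => (x, u, d) := by fun_prop
      exact hg (measurableSet_mem_beamArea P.N)
    simp_rw [hsplit]
    rw [lintegral_add_left (hmeas q₁ h₁ b), lintegral_finsetSum _ fun d _ => hmeas q₂ h₂ d]
    simp_rw [lintegral_beamArea_reverse u _ h₁, lintegral_beamArea_reverse u _ h₂]
    rw [Finset.sum_const, Finset.card_erase_of_mem (Finset.mem_univ b), Finset.card_univ,
      Fintype.card_fin, nsmul_eq_mul, hm1, ← mul_assoc, ← ENNReal.ofReal_mul hN1]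
    congr 3
    field_simp
  · have : beamLaw P p b = uniformOn Set.univ := by
      cases p <;> first | rfl | exact absurd rfl hp
    rw [this]
    exact huni

/-- The mean of `1 - exp (-T z F / ℓ)` over the fading power `F` and the path loss `ℓ` of a link
of length `r`. -/
noncomputable def interfererKernel (z T r : ℝ) : ℝ≥0∞ :=
  ENNReal.ofReal (P.h r) * ENNReal.ofReal (T * z / (T * z + pathLoss P true r)) +
    ENNReal.ofReal (1 - P.h r) * ENNReal.ofReal (T * z / (T * z + pathLoss P false r))

lemma measurable_pathLoss_right (l : Bool) : Measurable (pathLoss P l) := by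
  unfold pathLoss; fun_prop

lemma measurable_interfererKernel (z T : ℝ) : Measurable (interfererKernel P z T) := by
  have := P.h_measurable
  have := measurable_pathLoss_right P true
  have := measurable_pathLoss_right P false
  unfold interfererKernel
  fun_prop

/-- Merges the LOS and NLOS integrals into one radial integral, the form that the integration over a
sector produces. -/
lemma U_eq {z T : ℝ} (l : ℝ) (hz : 0 < z) (hT : 0 ≤ T) :
    U P z T l = (expNegE (ENNReal.ofReal (2 * Real.pi * l) *
      ∫⁻ r in Set.Ioi (0 : ℝ), ENNReal.ofReal r * interfererKernel P z T r)).toReal := by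
  have := P.h_measurable
  have := measurable_pathLoss_right P true
  have := measurable_pathLoss_right P false
  rw [U, expNeg_eq_toReal, ← lintegral_add_left (by fun_prop)]
  congr 3
  refine setLIntegral_congr_fun measurableSet_Ioi fun r hr => ?_
  have hr' : (0 : ℝ) < r := hr
  have h0 := P.h_nonneg r hr'.le
  have h1 := sub_nonneg.2 (P.h_le_one r hr'.le)
  have h2 := pathLoss_pos P true hr'
  have h3 := pathLoss_pos P false hr'
  simp only [interfererKernel]
  rw [← ENNReal.ofReal_mul h0, ← ENNReal.ofReal_mul h1,
    ← ENNReal.ofReal_add (by positivity) (by positivity),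
    ← ENNReal.ofReal_add (by positivity) (by positivity), ← ENNReal.ofReal_mul hr'.le]
  congr 1
  ring

end Spatial

/-! ### The contribution of one interferer -/

section Interferer

variable (P : Params) (p : Protocol)

/-- Values of `TypicalLink.geometry`. -/
abbrev LinkGeometry : Type := ℂ × Bool × Fin (p.Mra P) × Fin P.N × Fin P.NPA

variable {P p}

/-- Path loss of the typical link. -/
noncomputable def LinkGeometry.pathLoss (γ : LinkGeometry P p) : ℝ := MmWave.pathLoss P γ.2.1 ‖γ.1‖

/-- The SINR exceeds the threshold if the fading power of the typical link exceeds this multiple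
of the power of noise and interference. -/
noncomputable def LinkGeometry.fadingScale (γ : LinkGeometry P p) : ℝ :=
  P.Γra * γ.pathLoss / (P.Pu * p.Mra P * mainGain P (2 * Real.pi / (P.N : ℝ)))

open Classical in
/-- Power received by the tagged BS from a user at `x` with mark `m`, if it has the preamble of
the typical user. -/
noncomputable def LinkGeometry.userPower (γ : LinkGeometry P p) (x : ℂ) (m : UserMark P) : ℝ≥0∞ :=
  if m.1 = γ.2.2.2.2 then
    ENNReal.ofReal (P.Pu * (if x ∈ beamArea γ.1 (p.Mra P) γ.2.2.1 then (p.Mra P : ℝ) else 0) *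
      (if γ.1 ∈ beamArea x P.N m.2.2.1 then mainGain P (2 * Real.pi / (P.N : ℝ))
        else sideGain P (2 * Real.pi / (P.N : ℝ))) *
      m.2.2.2 / MmWave.pathLoss P m.2.1 ‖x - γ.1‖)
  else 0

lemma LinkGeometry.measurable_pathLoss :
    Measurable (LinkGeometry.pathLoss : LinkGeometry P p → ℝ) := by
  have h : Measurable fun γ : LinkGeometry P p => (γ.2.1, ‖γ.1‖) := by fun_prop
  exact (MmWave.measurable_pathLoss P).comp h

lemma LinkGeometry.measurable_fadingScale :
    Measurable (LinkGeometry.fadingScale : LinkGeometry P p → ℝ) :=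
  (LinkGeometry.measurable_pathLoss.const_mul _).div_const _

lemma LinkGeometry.measurable_userPower :
    Measurable fun q : LinkGeometry P p × ℂ × UserMark P => q.1.userPower q.2.1 q.2.2 := by
  have h1 : MeasurableSet {q : LinkGeometry P p × ℂ × UserMark P |
      q.2.1 ∈ beamArea q.1.1 (p.Mra P) q.1.2.2.1} := by
    have h : Measurable fun q : LinkGeometry P p × ℂ × UserMark P =>
      (q.1.1, q.2.1, q.1.2.2.1) := by fun_prop
    exact h (measurableSet_mem_beamArea _)
  have h2 : MeasurableSet {q : LinkGeometry P p × ℂ × UserMark P |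
      q.1.1 ∈ beamArea q.2.1 P.N q.2.2.2.2.1} := by
    have h : Measurable fun q : LinkGeometry P p × ℂ × UserMark P =>
      (q.2.1, q.1.1, q.2.2.2.2.1) := by fun_prop
    exact h (measurableSet_mem_beamArea _)
  have h3 : MeasurableSet {q : LinkGeometry P p × ℂ × UserMark P | q.2.2.1 = q.1.2.2.2.2} :=
    measurableSet_eq_fun (by fun_prop) (by fun_prop)
  have h4 : Measurable fun q : LinkGeometry P p × ℂ × UserMark P =>
      MmWave.pathLoss P q.2.2.2.1 ‖q.2.1 - q.1.1‖ := by
    have h : Measurable fun q : LinkGeometry P p × ℂ × UserMark P =>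
      (q.2.2.2.1, ‖q.2.1 - q.1.1‖) := by fun_prop
    exact (MmWave.measurable_pathLoss P).comp h
  unfold LinkGeometry.userPower
  refine Measurable.ite h3 (Measurable.ennreal_ofReal ?_) measurable_const
  refine Measurable.div (Measurable.mul (Measurable.mul (Measurable.const_mul ?_ _) ?_) ?_) h4
  · exact Measurable.ite h1 measurable_const measurable_const
  · exact Measurable.ite h2 measurable_const measurable_const
  · fun_prop

/-- Power received from a user, in units of fading power of the typical link at the threshold. -/
@[irreducible]
noncomputable def LinkGeometry.scaledPower (γ : LinkGeometry P p) (x : ℂ) (m : UserMark P) : ℝ≥0∞ :=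
  ENNReal.ofReal γ.fadingScale * γ.userPower x m

lemma LinkGeometry.measurable_scaledPower {α : Type*} [MeasurableSpace α]
    {f₁ : α → LinkGeometry P p} {f₂ : α → ℂ} {f₃ : α → UserMark P} (h₁ : Measurable f₁)
    (h₂ : Measurable f₂) (h₃ : Measurable f₃) :
    Measurable fun a => (f₁ a).scaledPower (f₂ a) (f₃ a) := by
  have h4 : Measurable fun a => (f₁ a, f₂ a, f₃ a) := h₁.prodMk (h₂.prodMk h₃)
  have h5 : Measurable fun a => (f₁ a).userPower (f₂ a) (f₃ a) :=
    LinkGeometry.measurable_userPower.comp h4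
  have h6 : Measurable fun a => (f₁ a).fadingScale := LinkGeometry.measurable_fadingScale.comp h₁
  simp only [LinkGeometry.scaledPower]
  exact h6.ennreal_ofReal.mul h5

/-- Factor of a user at `x` in the Laplace transform of the interference. -/
@[irreducible]
noncomputable def LinkGeometry.userFactor (γ : LinkGeometry P p) (x : ℂ) : ℝ≥0∞ :=
  ∫⁻ m, expNegE (γ.scaledPower x m) ∂markLaw P p γ.2.2.2.1 ‖x - γ.1‖

lemma LinkGeometry.userFactor_le_one (γ : LinkGeometry P p) (x : ℂ) : γ.userFactor x ≤ 1 := by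
  have := isProbabilityMeasure_markLaw P p γ.2.2.2.1 (norm_nonneg (x - γ.1))
  rw [LinkGeometry.userFactor]
  exact (lintegral_mono fun m => expNegE_le_one _).trans (by simp)

lemma LinkGeometry.one_sub_userFactor (γ : LinkGeometry P p) (x : ℂ) :
    1 - γ.userFactor x =
      ∫⁻ m, (1 - expNegE (γ.scaledPower x m)) ∂markLaw P p γ.2.2.2.1 ‖x - γ.1‖ := by
  have := isProbabilityMeasure_markLaw P p γ.2.2.2.1 (norm_nonneg (x - γ.1))
  have hm : Measurable fun m => expNegE (γ.scaledPower x m) := measurable_expNegE.comp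
    (LinkGeometry.measurable_scaledPower measurable_const measurable_const measurable_id)
  have hle := γ.userFactor_le_one x
  rw [LinkGeometry.userFactor] at hle ⊢
  rw [lintegral_sub hm (ne_top_of_le_ne_top ENNReal.one_ne_top hle)
    (ae_of_all _ fun m => expNegE_le_one _), lintegral_one, measure_univ]

lemma LinkGeometry.measurable_userFactor :
    Measurable fun q : LinkGeometry P p × ℂ => q.1.userFactor q.2 := by
  have hm : Measurable fun q : LinkGeometry P p × ℂ => (q.1.2.2.2.1, ‖q.2 - q.1.1‖) := by
    fun_prop
  have hK : Measurable fun q : LinkGeometry P p × ℂ =>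
      markLaw P p q.1.2.2.2.1 ‖q.2 - q.1.1‖ := (measurable_markLaw P p).comp hm
  have (q : LinkGeometry P p × ℂ) :
      IsProbabilityMeasure (markLaw P p q.1.2.2.2.1 ‖q.2 - q.1.1‖) :=
    isProbabilityMeasure_markLaw P p _ (norm_nonneg _)
  have hf : Measurable fun a : (LinkGeometry P p × ℂ) × UserMark P =>
      expNegE (LinkGeometry.scaledPower a.1.1 a.1.2 a.2) :=
    measurable_expNegE.comp (LinkGeometry.measurable_scaledPower (by fun_prop) (by fun_prop)
      (by fun_prop))
  simp only [LinkGeometry.userFactor]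
  exact measurable_lintegral_of_isProbabilityMeasure hK hf

open Classical in
/-- Mean of one factor of the Laplace transform of the interference over the mark of a user. -/
lemma lintegral_one_sub_userPower (γ : LinkGeometry P p) {x : ℂ} (hx : x ≠ γ.1) :
    ∫⁻ m, (1 - expNegE (γ.scaledPower x m))
        ∂markLaw P p γ.2.2.2.1 ‖x - γ.1‖ =
      (P.NPA : ℝ≥0∞)⁻¹ * if x ∈ beamArea γ.1 (p.Mra P) γ.2.2.1 then
        ∫⁻ d, (if γ.1 ∈ beamArea x P.N d then interfererKernel P γ.pathLoss P.Γra ‖x - γ.1‖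
          else interfererKernel P γ.pathLoss (sideGain P (2 * Real.pi / (P.N : ℝ)) /
            mainGain P (2 * Real.pi / (P.N : ℝ)) * P.Γra) ‖x - γ.1‖)
          ∂beamLaw P p γ.2.2.2.1 else 0 := by
  have hr : 0 < ‖x - γ.1‖ := norm_pos_iff.2 (sub_ne_zero.2 hx)
  set r := ‖x - γ.1‖ with hrdef
  have hM : (0 : ℝ) < p.Mra P := Nat.cast_pos.2 γ.2.2.1.pos
  have hG := mainGain_pos P
  have hg := sideGain_nonneg P
  set G := mainGain P (2 * Real.pi / (P.N : ℝ)) with hGdef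
  set g := sideGain P (2 * Real.pi / (P.N : ℝ)) with hgdef
  have hz : 0 ≤ γ.pathLoss := pathLoss_nonneg P _ (norm_nonneg _)
  have hPu := P.Pu_pos
  have hΓ := P.Γra_pos
  have hk : 0 ≤ γ.fadingScale := by unfold LinkGeometry.fadingScale; positivity
  have hmeas : Measurable fun m : UserMark P =>
      1 - expNegE (γ.scaledPower x m) := by
    exact measurable_const.sub (measurable_expNegE.comp
      (LinkGeometry.measurable_scaledPower measurable_const measurable_const measurable_id))
  -- The effective threshold: after division by the main-lobe gain of the typical link, an
  -- interferer in main-lobe position counts with ratio 1 and any other with ratio g/G.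
  let T : Fin P.N → ℝ := fun d => if γ.1 ∈ beamArea x P.N d then P.Γra else g / G * P.Γra
  have hgiven : ∀ l : Bool, ∫⁻ m, (1 - expNegE (γ.scaledPower x m))
      ∂markLawGiven P p γ.2.2.2.1 l = (P.NPA : ℝ≥0∞)⁻¹ *
        if x ∈ beamArea γ.1 (p.Mra P) γ.2.2.1 then
          ∫⁻ d, ENNReal.ofReal (T d * γ.pathLoss / (T d * γ.pathLoss + pathLoss P l r))
            ∂beamLaw P p γ.2.2.2.1 else 0 := by
    intro l
    have hl := pathLoss_pos P l hr
    rw [lintegral_markLawGiven P p _ l hmeas, lintegral_uniformOn_univ, Fintype.card_fin]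
    congr 1
    -- A user with another preamble has power zero and contributes 1 - exp(0) = 0, so the uniform
    -- choice leaves the factor 1/N_PA.
    rw [Finset.sum_eq_single γ.2.2.2.2]
    · by_cases hmem : x ∈ beamArea γ.1 (p.Mra P) γ.2.2.1
      · rw [if_pos hmem]
        refine lintegral_congr fun d => ?_
        have hT : 0 ≤ T d := by
          simp only [T]; split_ifs <;> positivity
        have hc : 0 ≤ T d * γ.pathLoss / pathLoss P l r := by positivity
        have e : ∀ y, γ.scaledPower x (γ.2.2.2.2, l, d, y) =
            ENNReal.ofReal (T d * γ.pathLoss / pathLoss P l r * y) := by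
          intro y
          simp only [LinkGeometry.scaledPower, LinkGeometry.userPower, if_true, if_pos hmem]
          rw [← ENNReal.ofReal_mul hk]
          congr 1
          simp only [LinkGeometry.fadingScale, T, ← hrdef, ← hGdef, ← hgdef]
          split_ifs <;> field_simp
        simp_rw [e]
        rw [lintegral_one_sub_expNegE_expMeasure hc]
        congr 1
        field_simp
        ring
      · simp [LinkGeometry.scaledPower, LinkGeometry.userPower, hmem]
    · intro c _ hc
      simp [LinkGeometry.scaledPower, LinkGeometry.userPower, hc]
    · simp
  rw [markLaw_eq, lintegral_add_measure, lintegral_smul_measure, lintegral_smul_measure,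
    hgiven, hgiven, smul_eq_mul, smul_eq_mul]
  by_cases hmem : x ∈ beamArea γ.1 (p.Mra P) γ.2.2.1
  · simp only [if_pos hmem]
    rw [mul_left_comm, mul_left_comm (ENNReal.ofReal (1 - P.h r)), ← mul_add,
      ← lintegral_const_mul _ (Measurable.of_discrete), ← lintegral_const_mul _ (Measurable.of_discrete),
      ← lintegral_add_left (Measurable.of_discrete)]
    congr 1
    refine lintegral_congr fun d => ?_
    simp only [T, interfererKernel]
    split_ifs <;> rfl
  · simp [hmem]

lemma sigmaFinite_ofReal_smul_volume (c : ℝ) :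
    SigmaFinite (ENNReal.ofReal c • (volume : Measure ℂ)) :=
  inferInstanceAs (SigmaFinite (c.toNNReal • (volume : Measure ℂ)))

/-- Probability that the signal of the typical user exceeds noise and interference, given the
geometry of its link. -/
lemma expNegE_noise_mul_expNegE_interference (γ : LinkGeometry P p) (hγ : γ.1 ≠ 0) :
    expNegE (ENNReal.ofReal γ.fadingScale * ENNReal.ofReal (P.σ ^ 2)) *
      expNegE (∫⁻ x, (1 - γ.userFactor x) ∂(ENNReal.ofReal (P.lamU * cellSearchProb P p) • (volume : Measure ℂ))) =
      ENNReal.ofReal (preambleProb P p γ.pathLoss) := by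
  classical
  have hz : 0 < γ.pathLoss := pathLoss_pos P _ (norm_pos_iff.2 hγ)
  have hM : (0 : ℝ) < p.Mra P := Nat.cast_pos.2 γ.2.2.1.pos
  have hN : (0 : ℝ) < P.N := Nat.cast_pos.2 P.N_pos
  have hA : (0 : ℝ) < P.NPA := Nat.cast_pos.2 P.NPA_pos
  have hN1 : (0 : ℝ) ≤ 1 - 1 / P.N := by
    rw [sub_nonneg, div_le_one hN]; exact_mod_cast P.N_pos
  have hG := mainGain_pos P
  have hg := sideGain_nonneg P
  have hpi := Real.pi_pos
  have hΓ := P.Γra_pos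
  have hPu := P.Pu_pos
  have hk : 0 ≤ γ.fadingScale := by unfold LinkGeometry.fadingScale; positivity
  -- A user exactly at the tagged BS would have path loss zero; this is one point of the plane,
  -- hence null.
  have hae : ∀ᵐ x : ℂ, x ≠ γ.1 := by
    simpa using measure_eq_zero_iff_ae_notMem.1 (measure_singleton (μ := (volume : Measure ℂ)) γ.1)
  simp_rw [LinkGeometry.one_sub_userFactor]
  rw [lintegral_smul_measure, lintegral_congr_ae (hae.mono fun x hx =>
    lintegral_one_sub_userPower γ hx), lintegral_const_mul' _ _ (by simp [P.NPA_pos.ne']),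
    lintegral_rxBeam P p γ.1 γ.2.2.1 γ.2.2.2.1 (measurable_interfererKernel P _ _)
      (measurable_interfererKernel P _ _)]
  have hT : 0 ≤ sideGain P (2 * Real.pi / (P.N : ℝ)) / mainGain P (2 * Real.pi / (P.N : ℝ)) *
    P.Γra := by positivity
  simp only [preambleProb, Protocol.max_Ncs_Nra]
  rw [U_eq P _ hz hΓ.le, U_eq P _ hz hT, ENNReal.ofReal_mul (q := ENNReal.toReal _) (by positivity),
    ENNReal.ofReal_mul (q := ENNReal.toReal _) (by positivity),
    ENNReal.ofReal_toReal (expNegE_ne_top _), ENNReal.ofReal_toReal (expNegE_ne_top _), mul_assoc]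
  refine congrArg₂ _ ?_ ?_
  · rw [← ENNReal.ofReal_mul hk, expNegE_ofReal (by positivity)]
    congr 3
    unfold LinkGeometry.fadingScale
    ring
  · have hinv : (P.NPA : ℝ≥0∞)⁻¹ = ENNReal.ofReal (1 / P.NPA) := by
      rw [one_div, ENNReal.ofReal_inv_of_pos hA, ENNReal.ofReal_natCast]
    -- Only the right-hand factors are shown to be nonnegative. The sign of the cell-search value is
    -- not needed, since the intensity and the arguments of `U` pass through the same truncation at
    -- zero.
    rw [← expNegE_add, hinv, smul_eq_mul, mul_add, mul_add, ← mul_assoc, ← mul_assoc, ← mul_assoc, ← mul_assoc,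
      ← ENNReal.ofReal_mul' (by positivity), ← ENNReal.ofReal_mul' (by positivity),
      ← ENNReal.ofReal_mul' (by positivity)]
    congr 3 <;> exact congrArg ENNReal.ofReal (by ring)

end Interferer

end MmWave

/-! ### Integrating out an independent variable -/

lemma ProbabilityTheory.IndepFun.setLIntegral_comp_prodMk {Ω S T : Type*} [MeasurableSpace Ω]
    [MeasurableSpace S] [MeasurableSpace T] {μ : Measure Ω} [IsProbabilityMeasure μ] {X : Ω → S}
    {Y : Ω → T} (h : IndepFun X Y μ) (hX : Measurable X) (hY : Measurable Y)
    {f : S × T → ℝ≥0∞} (hf : Measurable f) {A : Set S} (hA : MeasurableSet A) :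
    ∫⁻ ω in X ⁻¹' A, f (X ω, Y ω) ∂μ = ∫⁻ ω in X ⁻¹' A, ∫⁻ ω', f (X ω, Y ω') ∂μ ∂μ := by
  have : IsProbabilityMeasure (μ.map X) := Measure.isProbabilityMeasure_map hX.aemeasurable
  have : IsProbabilityMeasure (μ.map Y) := Measure.isProbabilityMeasure_map hY.aemeasurable
  have hXY := (indepFun_iff_map_prod_eq_prod_map_map hX.aemeasurable hY.aemeasurable).1 h
  have h1 := setLIntegral_map (μ := μ) (hA.prod MeasurableSet.univ) hf (hX.prodMk hY)
  have e : (fun ω => (X ω, Y ω)) ⁻¹' A ×ˢ Set.univ = X ⁻¹' A := by ext ω; simp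
  rw [e] at h1
  rw [← h1, hXY, ← Measure.prod_restrict, Measure.restrict_univ,
    lintegral_prod _ hf.aemeasurable, setLIntegral_map hA hf.lintegral_prod_right' hX]
  refine lintegral_congr fun ω => ?_
  exact lintegral_map (hf.comp measurable_prodMk_left) hY

/-- An independent exponential random variable exceeds a random level. -/
lemma measure_preimage_inter_fading {Ω S : Type*} [MeasurableSpace Ω] [MeasurableSpace S]
    {μ : Measure Ω} [IsProbabilityMeasure μ] {F : Ω → ℝ} {Y : Ω → S} (hF : Measurable F)
    (hY : Measurable Y) (hlaw : μ.map F = expMeasure 1) (h : IndepFun F Y μ) {J : S → ℝ≥0∞}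
    (hJ : Measurable J) {A : Set S} (hA : MeasurableSet A) {rel : ℝ≥0∞ → ℝ≥0∞ → Prop}
    (hrel : MeasurableSet {q : ℝ≥0∞ × ℝ≥0∞ | rel q.1 q.2})
    (hexp : ∀ a, expMeasure 1 {x | rel a (ENNReal.ofReal x)} = expNegE a) :
    μ (Y ⁻¹' A ∩ {ω | rel (J (Y ω)) (ENNReal.ofReal (F ω))}) =
      ∫⁻ ω in Y ⁻¹' A, expNegE (J (Y ω)) ∂μ := by
  -- Keeping the relation abstract treats ≤ and < at once; all that matters is that the exponential
  -- law gives both the tail exp(-a).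
  have hR : MeasurableSet {q : S × ℝ | rel (J q.1) (ENNReal.ofReal q.2)} := by
    have hm : Measurable fun q : S × ℝ => (J q.1, ENNReal.ofReal q.2) := by fun_prop
    exact hm hrel
  have hRω : MeasurableSet {ω | rel (J (Y ω)) (ENNReal.ofReal (F ω))} := (hY.prodMk hF) hR
  have h1 := h.symm.setLIntegral_comp_prodMk hY hF (measurable_one.indicator hR) hA
  have h2 : ∫⁻ ω in Y ⁻¹' A,
      {q : S × ℝ | rel (J q.1) (ENNReal.ofReal q.2)}.indicator 1 (Y ω, F ω) ∂μ =
      μ (Y ⁻¹' A ∩ {ω | rel (J (Y ω)) (ENNReal.ofReal (F ω))}) := by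
    rw [Set.inter_comm, ← Measure.restrict_apply hRω, ← lintegral_indicator_one hRω]
    rfl
  rw [← h2, h1]
  refine lintegral_congr fun ω => ?_
  have hS : MeasurableSet {x : ℝ | rel (J (Y ω)) (ENNReal.ofReal x)} :=
    (measurable_prodMk_left (x := Y ω)) hR
  rw [← hexp, ← hlaw, Measure.map_apply hF hS, ← lintegral_indicator_one (hF hS)]
  rfl

namespace MmWave

/-! ### The random access model -/

section RandomAccess

variable {Ω : Type*} {P : Params} {p : Protocol} {L : TypicalLink P p Ω} {R : OtherUsers P Ω}

lemma interference_eq_tsum (ω : Ω) : interference L R ω =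
    ∑' i, if (R.points ω i).1 = true then
      LinkGeometry.userPower (L.geometry ω) (R.points ω i).2 (R.mark i ω) else 0 := by
  unfold interference
  refine tsum_congr fun i => ?_
  rw [ite_and]
  rfl

variable [MeasurableSpace Ω] {μ : Measure Ω}

lemma IsRandomAccessModel.measurable_points (h : IsRandomAccessModel P p μ L R) :
    Measurable R.points :=
  measurable_pi_lambda _ fun i =>
    (h.users.measurable_present i).prodMk (h.users.measurable_loc i)

lemma IsRandomAccessModel.measurable_interference (h : IsRandomAccessModel P p μ L R) :
    Measurable (interference L R) := by
  have hg := h.measurable_geometry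
  have hpts := h.measurable_points
  have hmark := h.marks.1
  rw [funext (interference_eq_tsum (L := L) (R := R))]
  refine Measurable.tsum fun i => ?_
  have hpi : Measurable fun ω => R.points ω i := (measurable_pi_apply i).comp hpts
  refine Measurable.ite ?_ ?_ measurable_const
  · exact (measurable_fst.comp hpi) (measurableSet_singleton true)
  · exact LinkGeometry.measurable_userPower.comp
      (hg.prodMk ((measurable_snd.comp hpi).prodMk (hmark i)))

/-- Alignment fixes the gains of the typical link at M_ra and G, and X₀ ≠ 0 makes its path loss
positive. The noise power is nonzero, so the SINR inequality can be cleared of denominators even if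
the interference is infinite. -/
lemma IsRandomAccessModel.ae_sinr_iff (h : IsRandomAccessModel P p μ L R) : ∀ᵐ ω ∂μ,
    (ENNReal.ofReal P.Γra ≤ preambleSINR L R ω ↔
      ENNReal.ofReal (LinkGeometry.fadingScale (L.geometry ω)) *
        (interference L R ω + ENNReal.ofReal (P.σ ^ 2)) ≤ ENNReal.ofReal (L.F₀ ω)) ∧
    (ENNReal.ofReal P.Γra < preambleSINR L R ω ↔
      ENNReal.ofReal (LinkGeometry.fadingScale (L.geometry ω)) *
        (interference L R ω + ENNReal.ofReal (P.σ ^ 2)) < ENNReal.ofReal (L.F₀ ω)) := by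
  filter_upwards [h.X₀_ne, h.rx_aligned, h.tx_aligned] with ω h0 hrx htx
  have hz : 0 < L.Z₀ ω := pathLoss_pos P _ (norm_pos_iff.2 h0)
  have hM : (0 : ℝ) < p.Mra P := Nat.cast_pos.2 (L.rxBeam ω).pos
  have hG := mainGain_pos P
  have hPu := P.Pu_pos
  have hΓ := P.Γra_pos
  set G := mainGain P (2 * Real.pi / (P.N : ℝ)) with hGdef
  set J := interference L R ω + ENNReal.ofReal (P.σ ^ 2) with hJdef
  have hJ0 : J ≠ 0 := by
    have : 0 < ENNReal.ofReal (P.σ ^ 2) := ENNReal.ofReal_pos.2 (pow_pos P.σ_pos 2)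
    exact (this.trans_le le_add_self).ne'
  set a : ℝ := P.Pu * p.Mra P * G / L.Z₀ ω with hadef
  have ha : 0 < a := by positivity
  have hnum : ENNReal.ofReal (P.Pu * rxGain L ω 0 * txGain L ω 0 (L.txBeam ω) * L.F₀ ω / L.Z₀ ω) =
      ENNReal.ofReal a * ENNReal.ofReal (L.F₀ ω) := by
    rw [rxGain, txGain, if_pos hrx, if_pos htx, ← hGdef, ← ENNReal.ofReal_mul ha.le]
    congr 1
    rw [hadef]; ring
  have hΓa : ENNReal.ofReal P.Γra * J =
      ENNReal.ofReal a * (ENNReal.ofReal (LinkGeometry.fadingScale (L.geometry ω)) * J) := by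
    rw [← mul_assoc, ← ENNReal.ofReal_mul ha.le]
    congr 2
    have e : LinkGeometry.fadingScale (L.geometry ω) = P.Γra * L.Z₀ ω / (P.Pu * p.Mra P * G) := rfl
    rw [e, hadef]
    field_simp
  have ha0 : ENNReal.ofReal a ≠ 0 := (ENNReal.ofReal_pos.2 ha).ne'
  rw [preambleSINR, hnum, ← hJdef]
  constructor
  · rw [ENNReal.le_div_iff_mul_le (Or.inl hJ0) (Or.inr (by finiteness)), hΓa,
      ENNReal.mul_le_mul_iff_right ha0 ENNReal.ofReal_ne_top]
  · rw [ENNReal.lt_div_iff_mul_lt (Or.inl hJ0) (Or.inr (by finiteness)), hΓa,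
      ENNReal.mul_lt_mul_iff_right ha0 ENNReal.ofReal_ne_top]

variable [IsProbabilityMeasure μ]

/-- Laplace functional of the users, averaged over their marks, for a fixed link geometry. -/
lemma IsRandomAccessModel.lintegral_expNegE_points (h : IsRandomAccessModel P p μ L R)
    (γ : LinkGeometry P p) (hγ : γ.1 ≠ 0) :
    ∫⁻ ω, expNegE (ENNReal.ofReal γ.fadingScale * ENNReal.ofReal (P.σ ^ 2) +
      ∑' i, if (R.points ω i).1 = true then negLogE (γ.userFactor (R.points ω i).2) else 0) ∂μ =
      ENNReal.ofReal (preambleProb P p γ.pathLoss) := by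
  have := sigmaFinite_ofReal_smul_volume (P.lamU * cellSearchProb P p)
  have hv : Measurable γ.userFactor := by
    have hv' := LinkGeometry.measurable_userFactor.comp (measurable_prodMk_left (x := γ))
    exact hv'
  have hL := h.users.lintegral_expNegE_pointSum (measurable_negLogE.comp hv)
  have hr : ∀ x, 1 - expNegE ((negLogE ∘ γ.userFactor) x) = 1 - γ.userFactor x := fun x => by
    rw [Function.comp_apply, expNegE_negLogE (γ.userFactor_le_one x)]
  simp_rw [hr] at hL
  simp_rw [expNegE_add]
  rw [lintegral_const_mul' _ _ (expNegE_ne_top _), ← expNegE_noise_mul_expNegE_interference γ hγ,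
    ← hL]
  rfl

/-- Laplace transform of noise and interference at a level that depends on the link. -/
lemma IsRandomAccessModel.setLIntegral_expNegE_interference (h : IsRandomAccessModel P p μ L R)
    {A : Set (LinkGeometry P p)} (hA : MeasurableSet A) :
    ∫⁻ ω in L.geometry ⁻¹' A, expNegE (ENNReal.ofReal (LinkGeometry.fadingScale (L.geometry ω)) *
      (interference L R ω + ENNReal.ofReal (P.σ ^ 2))) ∂μ =
    ∫⁻ ω in L.geometry ⁻¹' A, ENNReal.ofReal (preambleProb P p (L.Z₀ ω)) ∂μ := by
  have hg := h.measurable_geometry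
  have hpts := h.measurable_points
  -- The marks are averaged given both the geometry and the points. Independence of the points from
  -- the geometry is used only afterwards, when no marks are left.
  let X : Ω → LinkGeometry P p × (ℕ → Bool × ℂ) := fun ω => (L.geometry ω, R.points ω)
  have hX : Measurable X := hg.prodMk hpts
  let κ : ℕ → LinkGeometry P p × (ℕ → Bool × ℂ) → Measure (UserMark P) :=
    fun i x => markLaw P p x.1.2.2.2.1 ‖(x.2 i).2 - x.1.1‖
  have hκ : ∀ i, Measurable (κ i) := by
    intro i
    have hm : Measurable fun x : LinkGeometry P p × (ℕ → Bool × ℂ) =>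
        (x.1.2.2.2.1, ‖(x.2 i).2 - x.1.1‖) := by fun_prop
    exact (measurable_markLaw P p).comp hm
  have : ∀ i x, IsProbabilityMeasure (κ i x) := fun i x =>
    isProbabilityMeasure_markLaw P p _ (norm_nonneg _)
  let w : ℕ → LinkGeometry P p × (ℕ → Bool × ℂ) → UserMark P → ℝ≥0∞ := fun i x m =>
    if (x.2 i).1 = true then x.1.scaledPower (x.2 i).2 m else 0
  have hw : ∀ i, Measurable (Function.uncurry (w i)) := by
    intro i
    refine Measurable.ite ?_ ?_ measurable_const
    · have hm : Measurable fun q : (LinkGeometry P p × (ℕ → Bool × ℂ)) × UserMark P =>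
        (q.1.2 i).1 := by fun_prop
      exact hm (measurableSet_singleton true)
    · have hm : Measurable fun q : (LinkGeometry P p × (ℕ → Bool × ℂ)) × UserMark P =>
          LinkGeometry.scaledPower q.1.1 (q.1.2 i).2 q.2 :=
        LinkGeometry.measurable_scaledPower (by fun_prop) (by fun_prop) (by fun_prop)
      exact hm
  let c : LinkGeometry P p → ℝ≥0∞ := fun γ =>
    ENNReal.ofReal γ.fadingScale * ENNReal.ofReal (P.σ ^ 2)
  have hc : Measurable c := LinkGeometry.measurable_fadingScale.ennreal_ofReal.mul_const _
  have hA' : MeasurableSet (Prod.fst ⁻¹' A : Set (LinkGeometry P p × (ℕ → Bool × ℂ))) :=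
    measurable_fst hA
  have hscale : ∀ ω, ENNReal.ofReal (LinkGeometry.fadingScale (L.geometry ω)) *
      (interference L R ω + ENNReal.ofReal (P.σ ^ 2)) =
      c (X ω).1 + ∑' i, w i (X ω) (R.mark i ω) := by
    intro ω
    rw [interference_eq_tsum, mul_add, add_comm, ← ENNReal.tsum_mul_left]
    refine congrArg₂ _ rfl (tsum_congr fun i => ?_)
    simp only [w, X, LinkGeometry.scaledPower, mul_ite, mul_zero]
  have hmark := h.marks.setLIntegral_expNegE_tsum (κ := κ) hX hκ hw
    (c := fun x => c x.1) (hc.comp measurable_fst) hA'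
  -- An absent point has factor 1, whose negative logarithm is 0; what remains is a sum over the
  -- points of the process.
  have hfactor : ∀ x : LinkGeometry P p × (ℕ → Bool × ℂ), ∀ i,
      negLogE (∫⁻ m, expNegE (w i x m) ∂κ i x) =
        if (x.2 i).1 = true then negLogE (x.1.userFactor (x.2 i).2) else 0 := by
    intro x i
    by_cases hi : (x.2 i).1 = true
    · simp only [w, κ, if_pos hi, LinkGeometry.userFactor]
    · simp only [w, if_neg hi, expNegE_zero, lintegral_one, measure_univ]
      simp [negLogE]
  have hΦ : Measurable fun x : LinkGeometry P p × (ℕ → Bool × ℂ) => expNegE (c x.1 +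
      ∑' i, if (x.2 i).1 = true then negLogE (x.1.userFactor (x.2 i).2) else 0) := by
    refine measurable_expNegE.comp ((hc.comp measurable_fst).add (Measurable.tsum fun i => ?_))
    refine Measurable.ite ?_ ?_ measurable_const
    · have hm : Measurable fun x : LinkGeometry P p × (ℕ → Bool × ℂ) => (x.2 i).1 := by fun_prop
      exact hm (measurableSet_singleton true)
    · have hm : Measurable fun x : LinkGeometry P p × (ℕ → Bool × ℂ) => (x.1, (x.2 i).2) := by
        fun_prop
      have hm' : Measurable fun x : LinkGeometry P p × (ℕ → Bool × ℂ) =>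
          LinkGeometry.userFactor x.1 (x.2 i).2 := by
        have h := LinkGeometry.measurable_userFactor.comp hm
        exact h
      exact measurable_negLogE.comp hm'
  have hindep := h.users_indep.setLIntegral_comp_prodMk hg hpts hΦ hA
  calc _ = ∫⁻ ω in X ⁻¹' (Prod.fst ⁻¹' A), expNegE (c (X ω).1 +
        ∑' i, w i (X ω) (R.mark i ω)) ∂μ := by
        simp_rw [hscale]; rfl
    _ = ∫⁻ ω in L.geometry ⁻¹' A, ∫⁻ ω', expNegE (c (L.geometry ω) +
        ∑' i, if (R.points ω' i).1 = true then
          negLogE (LinkGeometry.userFactor (L.geometry ω) (R.points ω' i).2) else 0) ∂μ ∂μ := by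
        rw [hmark, ← hindep]
        simp_rw [hfactor]; rfl
    _ = _ := by
        refine lintegral_congr_ae (ae_restrict_of_ae ?_)
        filter_upwards [h.X₀_ne] with ω hω
        exact h.lintegral_expNegE_points (L.geometry ω) hω

/-- The level to be exceeded is a function of geometry, points and marks, all jointly independent of
F₀, so the fading integrates out to the Laplace transform already computed. -/
lemma IsRandomAccessModel.measure_preimage_inter (h : IsRandomAccessModel P p μ L R)
    {A : Set (LinkGeometry P p)} (hA : MeasurableSet A) {rel : ℝ≥0∞ → ℝ≥0∞ → Prop}
    (hrel : MeasurableSet {q : ℝ≥0∞ × ℝ≥0∞ | rel q.1 q.2})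
    (hexp : ∀ a, expMeasure 1 {x | rel a (ENNReal.ofReal x)} = expNegE a) :
    μ (L.geometry ⁻¹' A ∩ {ω | rel (ENNReal.ofReal (LinkGeometry.fadingScale (L.geometry ω)) *
      (interference L R ω + ENNReal.ofReal (P.σ ^ 2))) (ENNReal.ofReal (L.F₀ ω))}) =
    ∫⁻ ω in L.geometry ⁻¹' A, ENNReal.ofReal (preambleProb P p (L.Z₀ ω)) ∂μ := by
  let S := (LinkGeometry P p × (ℕ → Bool × ℂ)) × (ℕ → UserMark P)
  let Y : Ω → S := fun ω => ((L.geometry ω, R.points ω), fun i => R.mark i ω)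
  have hY : Measurable Y := (h.measurable_geometry.prodMk h.measurable_points).prodMk
    (measurable_pi_lambda _ fun i => h.marks.1 i)
  let J : S → ℝ≥0∞ := fun y => ENNReal.ofReal (LinkGeometry.fadingScale y.1.1) *
    ((∑' i, if (y.1.2 i).1 = true then y.1.1.userPower (y.1.2 i).2 (y.2 i) else 0) +
      ENNReal.ofReal (P.σ ^ 2))
  have hJ : Measurable J := by
    refine Measurable.mul ?_ (Measurable.add_const (Measurable.tsum fun i => ?_) _)
    · exact LinkGeometry.measurable_fadingScale.ennreal_ofReal.comp
        (measurable_fst.comp measurable_fst)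
    · refine Measurable.ite ?_ ?_ measurable_const
      · have hm : Measurable fun y : (LinkGeometry P p × (ℕ → Bool × ℂ)) × (ℕ → UserMark P) =>
          (y.1.2 i).1 := by fun_prop
        exact hm (measurableSet_singleton true)
      · have hm : Measurable fun y : (LinkGeometry P p × (ℕ → Bool × ℂ)) × (ℕ → UserMark P) =>
          (y.1.1, (y.1.2 i).2, y.2 i) := by fun_prop
        exact LinkGeometry.measurable_userPower.comp hm
  have hJY : ∀ ω, J (Y ω) = ENNReal.ofReal (LinkGeometry.fadingScale (L.geometry ω)) *
      (interference L R ω + ENNReal.ofReal (P.σ ^ 2)) := fun ω => by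
    rw [interference_eq_tsum]
  have hA' : MeasurableSet ((fun y : S => y.1.1) ⁻¹' A) :=
    (measurable_fst.comp measurable_fst) hA
  have key := measure_preimage_inter_fading h.measurable_F₀ hY h.fading_law h.fading_indep hJ hA'
    hrel hexp
  simp_rw [hJY] at key
  exact key.trans (h.setLIntegral_expNegE_interference hA)

/-! ### From joint to conditional probabilities -/

lemma preambleProb_nonneg (z : ℝ) : 0 ≤ preambleProb P p z := by
  simp only [preambleProb, U, expNeg_eq_toReal]
  positivity

lemma measurable_U (T l : ℝ) : Measurable fun z => U P z T l := by
  have hL := measurable_pathLoss_right P true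
  have hN := measurable_pathLoss_right P false
  have hh := P.h_measurable
  simp only [U, expNeg_eq_toReal]
  refine (measurable_expNegE.comp (Measurable.const_mul (Measurable.add ?_ ?_) _)).ennreal_toReal
  · refine Measurable.lintegral_prod_right' (f := fun q : ℝ × ℝ =>
      ENNReal.ofReal (T * q.1 * P.h q.2 * q.2 / (T * q.1 + pathLoss P true q.2))) ?_
    fun_prop
  · refine Measurable.lintegral_prod_right' (f := fun q : ℝ × ℝ =>
      ENNReal.ofReal (T * q.1 * (1 - P.h q.2) * q.2 / (T * q.1 + pathLoss P false q.2))) ?_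
    fun_prop

lemma measurable_preambleProb : Measurable (preambleProb P p) := by
  unfold preambleProb
  refine Measurable.mul (Measurable.mul ?_ (measurable_U _ _)) (measurable_U _ _)
  fun_prop

/-- The sets Z⁻¹(B) are all the events of the conditioning σ-algebra, and equal integrals over them
characterise the conditional expectation. Null-measurability of E suffices, which is what is
available for the SINR events: they agree with measurable sets only almost surely. -/
lemma condExp_indicator_ae_eq_comp {Z : Ω → ℝ} (hZ : Measurable Z) {E : Set Ω}
    (hE : NullMeasurableSet E μ) {g : ℝ → ℝ} (hg : Measurable g) (hg0 : ∀ z, 0 ≤ g z)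
    (h : ∀ B : Set ℝ, MeasurableSet B →
      μ (Z ⁻¹' B ∩ E) = ∫⁻ ω in Z ⁻¹' B, ENNReal.ofReal (g (Z ω)) ∂μ) :
    μ⟦E | MeasurableSpace.comap Z inferInstance⟧ =ᵐ[μ] fun ω => g (Z ω) := by
  have hint : Integrable (fun ω => g (Z ω)) μ := by
    refine ⟨(hg.comp hZ).aestronglyMeasurable, ?_⟩
    rw [hasFiniteIntegral_iff_ofReal (ae_of_all _ fun ω => hg0 _)]
    have := h Set.univ MeasurableSet.univ
    rw [Set.preimage_univ, Measure.restrict_univ] at this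
    rw [← this]
    exact measure_lt_top _ _
  have hEint : Integrable (E.indicator fun _ => (1 : ℝ)) μ :=
    (integrable_const 1).indicator₀ hE
  refine (ae_eq_condExp_of_forall_setIntegral_eq hZ.comap_le hEint
    (fun s _ _ => hint.integrableOn) ?_ ?_).symm
  · rintro _ ⟨B, hB, rfl⟩ -
    rw [integral_eq_lintegral_of_nonneg_ae (ae_of_all _ fun ω => hg0 _)
      (hg.comp hZ).aestronglyMeasurable, ← h B hB,
      integral_indicator₀ (hE.mono_ac Measure.restrict_le_self.absolutelyContinuous),
      setIntegral_const, smul_eq_mul, mul_one, Measure.real, Measure.restrict_apply₀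
        (hE.mono_ac Measure.restrict_le_self.absolutelyContinuous), Set.inter_comm]
  · exact (hg.comp (comap_measurable Z)).stronglyMeasurable.aestronglyMeasurable

lemma IsRandomAccessModel.condExp_ae_eq (h : IsRandomAccessModel P p μ L R) {E : Set Ω}
    {rel : ℝ≥0∞ → ℝ≥0∞ → Prop} (hrel : MeasurableSet {q : ℝ≥0∞ × ℝ≥0∞ | rel q.1 q.2})
    (hexp : ∀ a, expMeasure 1 {x | rel a (ENNReal.ofReal x)} = expNegE a)
    (hE : ∀ᵐ ω ∂μ, (ω ∈ E ↔ rel (ENNReal.ofReal (LinkGeometry.fadingScale (L.geometry ω)) *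
        (interference L R ω + ENNReal.ofReal (P.σ ^ 2))) (ENNReal.ofReal (L.F₀ ω)))) :
    μ⟦E | MeasurableSpace.comap L.Z₀ inferInstance⟧ =ᵐ[μ]
      fun ω => preambleProb P p (L.Z₀ ω) := by
  set E' := {ω | rel (ENNReal.ofReal (LinkGeometry.fadingScale (L.geometry ω)) *
    (interference L R ω + ENNReal.ofReal (P.σ ^ 2))) (ENNReal.ofReal (L.F₀ ω))} with hE'
  have hE'm : MeasurableSet E' := by
    have hm : Measurable fun ω => (ENNReal.ofReal (LinkGeometry.fadingScale (L.geometry ω)) *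
        (interference L R ω + ENNReal.ofReal (P.σ ^ 2)), ENNReal.ofReal (L.F₀ ω)) :=
      (((LinkGeometry.measurable_fadingScale.comp h.measurable_geometry).ennreal_ofReal).mul
        (h.measurable_interference.add_const _)).prodMk h.measurable_F₀.ennreal_ofReal
    exact hm hrel
  have hEE' : E =ᵐ[μ] E' := by
    filter_upwards [hE] with ω hω
    exact propext hω
  refine condExp_indicator_ae_eq_comp
    (LinkGeometry.measurable_pathLoss.comp h.measurable_geometry)
    (hE'm.nullMeasurableSet.congr hEE'.symm) measurable_preambleProb preambleProb_nonneg
    fun B hB => ?_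
  rw [measure_congr ((ae_eq_refl _).inter hEE')]
  -- Z₀ is a function of the geometry, so the event Z₀ ∈ B is an event about the geometry.
  exact h.measure_preimage_inter (LinkGeometry.measurable_pathLoss hB) hrel hexp

end RandomAccess

end MmWave

theorem mainTheorem7 {Ω : Type*} [MeasurableSpace Ω] (μ : Measure Ω) [IsProbabilityMeasure μ]
    (P : MmWave.Params) (p : MmWave.Protocol) (hp : p.Admissible P)
    (L : MmWave.TypicalLink P p Ω) (R : MmWave.OtherUsers P Ω)
    (hmodel : MmWave.IsRandomAccessModel P p μ L R) :
    μ⟦{ω | ENNReal.ofReal P.Γra ≤ MmWave.preambleSINR L R ω} |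
        MeasurableSpace.comap L.Z₀ inferInstance⟧ =ᵐ[μ]
      (fun ω => MmWave.preambleProb P p (L.Z₀ ω)) ∧
    μ⟦{ω | ENNReal.ofReal P.Γra < MmWave.preambleSINR L R ω} |
        MeasurableSpace.comap L.Z₀ inferInstance⟧ =ᵐ[μ]
      (fun ω => MmWave.preambleProb P p (L.Z₀ ω)) := by
  have h := hmodel.ae_sinr_iff
  exact ⟨hmodel.condExp_ae_eq (rel := (· ≤ ·)) (measurableSet_le measurable_fst measurable_snd)
      expMeasure_one_le_ofReal (h.mono fun _ hω => hω.1),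
    hmodel.condExp_ae_eq (rel := (· < ·)) (measurableSet_lt measurable_fst measurable_snd)
      expMeasure_one_lt_ofReal (h.mono fun _ hω => hω.2)⟩
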